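/- **Setting.** There are $n\ge 3f+1$ nodes $0,\dots,n-1$, at most $f$ of them faulty (Byzantine), and a set of clients, any of which may be faulty. A request is a triple $r=(o,(t,c))$ of a payload $o$, a timestamp $t\in\mathbb N$ and a client identifier $c$. A *batch* is a finite sequence of requests. Signatures are unforgeable: a signature of a correct client exists exactly on the requests it broadcasts. A correct client belongs to the client set, uses each timestamp at most once, uses contiguous timestamps starting from $0$, and as long as its request is delivered by no correct node it keeps transmitting the request to every correct node. **Sequenced broadcast.** An instance $SB(\sigma,S,M,D)$ with sender $\sigma$, sequence numbers $S$, messages $M$ and failure detector $D$ satisfies: correct nodes sb-deliver only pairs in $S\times(M\cup\{\bot\})$ and at most once per sequence number; *Integrity*: if $\sigma$ is correct and a correct node sb-delivers $(sn,m)$ with $m\ne\bot$, then $\sigma$ sb-cast $(sn,m)$; *Agreement*: if correct nodes sb-deliver $(sn,m)$ and $(sn,m')$ then $m=m'$; *Termination*: if all correct nodes initialize the instance, each of them sb-delivers a value for every $sn\in S$; *Eventual Progress*: if a correct node sb-delivers $(sn,\bot)$, then some correct node suspected $\sigma$ after initializing the instance. The failure detector satisfies *Eventual Weak Accuracy*: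 from some time on, some correct node is suspected by no correct node. **ISS.** Parameters: an epoch length $L$; a number of buckets, a maximal batch size, a watermark window size $W$ and a BACKOFF constant $d$, all at least $1$; and a ban period. Epoch $e$ has the sequence numbers $Sn(e)=\{eL,\dots,(e+1)L-1\}$. Request $r$ maps to the bucket given by a number computed from $(c,t)$, modulo the number of buckets. At the start of epoch $e$ each node computes from its log before epoch $e$: * the leaders $\ell_0<\dots<\ell_{m-1}$ of $e$. Say that $i$ *failed* at $sn$ if $i$ was responsible for $sn$ and the log entry at $sn$ is $\bot$. SIMPLE: all nodes lead. BLACKLIST: all nodes lead except those that have failed and for which fewer than $f$ nodes failed at a higher sequence number. BACKOFF: the nodes with penalty $\le 0$ lead; penalties are initially $0$, and at the end of every epoch a penalty $x$ becomes $2x-1$ (if $x>0$) or the ban period (if $x\le0$) for nodes that failed in this epoch, and for all other nodes it becomes $x-d$ if $x>0$ and stays $x$ if $x\le 0$. An epoch without leaders is skipped (its log entries are $\bot$); * the segments: $\ell_k$ is responsible for the $sn\in Sn(e)$ with $sn\equiv k \pmod m$. Its buckets are the $b$ with $b+e\equiv \ell_k\pmod n$, and those $b$ with $b+e\equiv k\pmod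 m$ for which the node congruent to $b+e$ modulo $n$ is not a leader; * request validity: a request is *valid* in $e$ if it is signed, its client is in the client set, and its timestamp lies in $[w,w+W)$, where $w$ is the least timestamp with which no request of that client is in the log before epoch $e$. For each segment the node initializes an SB instance whose sender is the leader and whose messages are the batches of valid requests that map to the buckets of the segment. On receiving a valid request for the first time, a node adds it to the queue of its bucket. A leader eventually sb-casts, for each of its $sn$ for which it has not sb-delivered anything yet, the batch of the (up to the maximal batch size) oldest valid requests, in order of reception, in the queues of its buckets, and removes them from the queues. On sb-delivering $(sn,v)$ a node sets its log entry at $sn$ to $v$; if $v\neq\bot$, it removes the requests of $v$ from its queues; if $v=\bot$ and it had proposed a batch for $sn$, it returns the requests of this batch to their queues, in their original order of reception. When the log has entries for all of $Sn(e)$, the node moves on to epoch $e+1$. Nodes deliver the batches of the log in order; the $k$-th request ($k\ge0$) of the batch at position $sn$ gets the sequence number $k+\sum_{i<sn}S_i$, where $S_i$ is the number of requests at position $i$ ($0$ for $\bot$). **Theorem.** For each of the three leader policies, every infinite execution of ISS satisfies: 1. *Integrity*: if a correct node delivers $(s,r)$ and the client of $r$ is correct, then this client broadcast $r$; 2. *Agreement*: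 if two correct nodes deliver $(s,r)$ and $(s,r')$ respectively, then $r=r'$; 3. *Totality*: if a correct node delivers $(s,r)$, then every correct node eventually delivers $(s,r)$; 4. *Liveness*: if $L\ge n$ (so that every leader is responsible for at least one sequence number), then every request broadcast by a correct client is eventually delivered by some correct node. -/

import Mathlib

universe u v

namespace ISS

/-! ### Requests, batches, logs -/

/-- A client request `r = (o, (t, c))`: payload `o`, logical timestamp `t`, client identifier `c`.
Two requests are equal (duplicates) iff all three components agree. -/
structure Request (Payload : Type u) (Client : Type v) where
  payload : Payload
  ts : ℕ
  client : Client

/-- A batch: a finite sequence of requests. -/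
abbrev Batch (Payload : Type u) (Client : Type v) := List (Request Payload Client)

/-- A log. `none` means that there is no entry yet, `some none` is the entry `⊥`,
`some (some b)` is the entry consisting of the batch `b`. -/
abbrev Log (Payload : Type u) (Client : Type v) := ℕ → Option (Option (Batch Payload Client))

/-- The three leader selection policies. -/
inductive Policy where
  | simple
  | backoff
  | blacklist

/-- The parameters of the algorithm, for the nodes `0, …, n - 1`. -/
structure Config (n : ℕ) (Client : Type v) where
  /-- bound on the number of faulty nodes -/
  f : ℕ
  policy : Policy
  numBuckets : ℕ
  epochLength : ℕ
  maxBatchSize : ℕ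
  /-- initial ban period of BACKOFF -/
  banPeriod : ℕ
  /-- constant decrease of the ban period of BACKOFF -/
  decrease : ℕ
  /-- width of the client watermark windows -/
  windowSize : ℕ
  /-- the client set of the system -/
  clients : Set Client
  /-- the number (concatenation of client identifier and timestamp) that is reduced modulo
  `numBuckets` in order to map a request to a bucket; it ignores the payload -/
  key : Client → ℕ → ℕ

/-- A segment, i.e. the parameters of an instance of sequenced broadcast `SB(leader, seqNrs, msgs)`,
together with its epoch and its buckets. -/
structure Segment (n : ℕ) (Payload : Type u) (Client : Type v) where
  epoch : ℕ
  leader : Fin n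
  seqNrs : Set ℕ
  buckets : Set ℕ
  msgs : Set (Batch Payload Client)

noncomputable section

section Epochs

variable {n : ℕ} {Payload : Type u} {Client : Type v}

/-- `Sn(e)`, the sequence numbers of epoch `e`. -/
def seqNrs (cfg : Config n Client) (e : ℕ) : Finset ℕ :=
  Finset.Ico (e * cfg.epochLength) ((e + 1) * cfg.epochLength)

/-- The bucket to which a request maps. -/
def bucketOf (cfg : Config n Client) (r : Request Payload Client) : ℕ :=
  cfg.key r.client r.ts % cfg.numBuckets

/-! ### Leader selection -/

/-- The leader responsible for the sequence number `sn`, when `hist e` is the list of leaders of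
epoch `e`: the one whose index is congruent to `sn` modulo the number of leaders (nobody, if the
epoch of `sn` has no leader). -/
def leaderOf (cfg : Config n Client) (hist : ℕ → List (Fin n)) (sn : ℕ) : Option (Fin n) :=
  (hist (sn / cfg.epochLength))[sn % (hist (sn / cfg.epochLength)).length]?

open Classical in
/-- The highest sequence number in the epochs before `e` for which `i` was the leader and for
which the log has the entry `⊥` (and `⊥ : WithBot ℕ` if there is none). -/
def lastFailure (cfg : Config n Client) (hist : ℕ → List (Fin n)) (log : Log Payload Client)
    (i : Fin n) (e : ℕ) : WithBot ℕ :=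
  ((Finset.range (e * cfg.epochLength)).filter
    (fun sn => leaderOf cfg hist sn = some i ∧ log sn = some none)).max

/-- At the end of epoch `e`: the last failure of `i` lies in epoch `e`. -/
def suspect (cfg : Config n Client) (hist : ℕ → List (Fin n)) (log : Log Payload Client)
    (i : Fin n) (e : ℕ) : Prop :=
  ∃ sn ∈ seqNrs cfg e, lastFailure cfg hist log i (e + 1) = (sn : WithBot ℕ)

open Classical in
/-- The penalty of node `i` at the start of epoch `e` (used by BACKOFF), updated at the end of
every epoch. -/
def penalty (cfg : Config n Client) (hist : ℕ → List (Fin n)) (log : Log Payload Client)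
    (i : Fin n) : ℕ → ℤ
  | 0 => 0
  | e + 1 =>
    if suspect cfg hist log i e then
      if 0 < penalty cfg hist log i e then penalty cfg hist log i e * 2 - 1 else cfg.banPeriod
    else
      if 0 < penalty cfg hist log i e then penalty cfg hist log i e - cfg.decrease
      else penalty cfg hist log i e

open Classical in
/-- `i` is one of the (at most `f`) nodes that failed most recently before epoch `e`. -/
def Blacklisted (cfg : Config n Client) (hist : ℕ → List (Fin n)) (log : Log Payload Client)
    (i : Fin n) (e : ℕ) : Prop :=
  lastFailure cfg hist log i e ≠ ⊥ ∧
    (Finset.univ.filter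
      (fun j => lastFailure cfg hist log i e < lastFailure cfg hist log j e)).card < cfg.f

open Classical in
/-- The leaders of epoch `e` in increasing order, given the leaders `hist` of the earlier epochs. -/
def policyLeaders (cfg : Config n Client) (hist : ℕ → List (Fin n)) (log : Log Payload Client)
    (e : ℕ) : List (Fin n) :=
  match cfg.policy with
  | .simple => List.finRange n
  | .backoff => (List.finRange n).filter (fun i => penalty cfg hist log i e ≤ 0)
  | .blacklist => (List.finRange n).filter (fun i => ¬ Blacklisted cfg hist log i e)

/-- The leaders of the epochs before `e` (and no leaders for the other epochs). -/
def leaderHistory (cfg : Config n Client) (log : Log Payload Client) : ℕ → ℕ → List (Fin n)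
  | 0 => fun _ => []
  | e + 1 => Function.update (leaderHistory cfg log e) e
      (policyLeaders cfg (leaderHistory cfg log e) log e)

/-- The leaders of epoch `e`, a function of `e` and of the log before epoch `e`. -/
def leaders (cfg : Config n Client) (log : Log Payload Client) (e : ℕ) : List (Fin n) :=
  policyLeaders cfg (leaderHistory cfg log e) log e

/-! ### Buckets -/

/-- The buckets initially assigned to node `i` in epoch `e`. -/
def initBuckets (cfg : Config n Client) (e : ℕ) (i : Fin n) : Set ℕ :=
  {b | b < cfg.numBuckets ∧ (b + e) % n = i}

/-- The buckets initially assigned to the nodes outside the list `ls` of leaders. -/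
def extraBuckets (cfg : Config n Client) (ls : List (Fin n)) (e : ℕ) : Set ℕ :=
  {b | ∃ i : Fin n, i ∉ ls ∧ b ∈ initBuckets cfg e i}

/-- The buckets of the leader `i` in epoch `e`, when `ls` is the list of leaders. -/
def activeBuckets (cfg : Config n Client) (ls : List (Fin n)) (e : ℕ) (i : Fin n) : Set ℕ :=
  initBuckets cfg e i ∪ {b | b ∈ extraBuckets cfg ls e ∧ (b + e) % ls.length = ls.idxOf i}

/-! ### Request validity -/

/-- The lower end of the watermark window of client `c` in epoch `e`: the least timestamp with
which no request of `c` is in the log before epoch `e`. -/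
def lowWatermark (cfg : Config n Client) (log : Log Payload Client) (e : ℕ) (c : Client) : ℕ :=
  sInf {t | ∀ sn < e * cfg.epochLength, ∀ b, log sn = some (some b) →
    ∀ r ∈ b, r.client = c → r.ts ≠ t}

/-- A request is valid in epoch `e` if it carries a valid signature of its client (`signed` is the
set of requests for which such a signature exists), the client is in the client set, and the
timestamp is in the watermark window of the client. -/
def Valid (cfg : Config n Client) (signed : Set (Request Payload Client))
    (log : Log Payload Client) (e : ℕ) (r : Request Payload Client) : Prop :=
  r ∈ signed ∧ r.client ∈ cfg.clients ∧
    lowWatermark cfg log e r.client ≤ r.ts ∧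
    r.ts < lowWatermark cfg log e r.client + cfg.windowSize

/-- `batches(B)`: the batches of valid requests that map to buckets in `B`. -/
def batches (cfg : Config n Client) (signed : Set (Request Payload Client))
    (log : Log Payload Client) (e : ℕ) (B : Set ℕ) : Set (Batch Payload Client) :=
  {b | ∀ r ∈ b, Valid cfg signed log e r ∧ bucketOf cfg r ∈ B}

/-- The segments of epoch `e`: one for every leader, with the sequence numbers of the epoch
assigned round-robin. -/
def segments (cfg : Config n Client) (signed : Set (Request Payload Client))
    (log : Log Payload Client) (e : ℕ) : Set (Segment n Payload Client) :=
  {I | ∃ (l : ℕ) (hl : l < (leaders cfg log e).length), I =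
    { epoch := e
      leader := (leaders cfg log e)[l]
      seqNrs := {sn | sn ∈ seqNrs cfg e ∧ sn % (leaders cfg log e).length = l}
      buckets := activeBuckets cfg (leaders cfg log e) e (leaders cfg log e)[l]
      msgs := batches cfg signed log e
        (activeBuckets cfg (leaders cfg log e) e (leaders cfg log e)[l]) }}

open Classical in
/-- Skipping of epochs without leaders: if epoch `e` has no leader, then its log positions are
filled with `⊥` as soon as the epoch is entered. -/
def fillSkipped (cfg : Config n Client) (log : Log Payload Client) (e : ℕ) : Log Payload Client :=
  fun sn => if leaders cfg log e = [] ∧ sn ∈ seqNrs cfg e then some none else log sn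

end Epochs

/-! ### The algorithm at a node -/

section Algorithm

variable {n : ℕ} {Payload : Type u} {Client : Type v}

/-- The local state of a node. The bucket queues are represented by the list `received` of the
requests that were ever added to them, in the order of their reception, and the set `pending` of
those requests that are currently in their queue: the queue of bucket `b` consists of the requests
in `received` that are pending and map to `b`, oldest first. -/
structure NodeState (Payload : Type u) (Client : Type v) where
  epoch : ℕ
  log : Log Payload Client
  firstUndelivered : ℕ
  totalDelivered : ℕ
  received : List (Request Payload Client)
  pending : Set (Request Payload Client)
  proposed : ℕ → Option (Batch Payload Client)

/-- What a node can do in one step. -/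
inductive Event (n : ℕ) (Payload : Type u) (Client : Type v) where
  /-- nothing happens -/
  | idle
  /-- `SMR-CAST`: a request arrives -/
  | receive (r : Request Payload Client)
  /-- the node, as the leader of the segment `I`, sb-casts a batch for `sn` -/
  | propose (I : Segment n Payload Client) (sn : ℕ)
  /-- the node sb-delivers `(sn, v)` in the instance of `I`; here `none` is `⊥` -/
  | sbDeliver (I : Segment n Payload Client) (sn : ℕ) (v : Option (Batch Payload Client))
  /-- the node finishes its current epoch and starts the next one -/
  | advance
  /-- the node delivers the requests of its first undelivered log entry -/
  | deliver

/-- The initial state of every node, in epoch `0`. -/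
def initialState (cfg : Config n Client) : NodeState Payload Client where
  epoch := 0
  log := fillSkipped cfg (fun _ => none) 0
  firstUndelivered := 0
  totalDelivered := 0
  received := []
  pending := ∅
  proposed := fun _ => none

/-- The segments of the current epoch of a node, i.e. the current instances of sequenced broadcast
as the node has initialized them. -/
def NodeState.segments (cfg : Config n Client) (signed : Set (Request Payload Client))
    (s : NodeState Payload Client) : Set (Segment n Payload Client) :=
  ISS.segments cfg signed s.log s.epoch

open Classical in
/-- The `maxBatchSize` oldest requests in the queues of the buckets of `I` (only those that are
still valid in the current epoch). -/
def cutBatch (cfg : Config n Client) (signed : Set (Request Payload Client))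
    (s : NodeState Payload Client) (I : Segment n Payload Client) : Batch Payload Client :=
  (s.received.filter (fun r => r ∈ s.pending ∧ bucketOf cfg r ∈ I.buckets ∧
    Valid cfg signed s.log s.epoch r)).take cfg.maxBatchSize

/-- When node `p` in state `s` can execute an event. The time at which it proposes is not
restricted (it depends on its batch timeout). -/
def Enabled (cfg : Config n Client) (signed : Set (Request Payload Client)) (p : Fin n)
    (s : NodeState Payload Client) : Event n Payload Client → Prop
  | .idle => True
  | .receive _ => True
  | .propose I sn => I ∈ s.segments cfg signed ∧ I.leader = p ∧ sn ∈ I.seqNrs ∧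
      s.proposed sn = none ∧ s.log sn = none
  | .sbDeliver I _ _ => I ∈ s.segments cfg signed
  | .advance => ∀ sn ∈ seqNrs cfg s.epoch, s.log sn ≠ none
  | .deliver => s.log s.firstUndelivered ≠ none

open Classical in
/-- The effect of an event on the state of a node. -/
def next (cfg : Config n Client) (signed : Set (Request Payload Client))
    (s : NodeState Payload Client) : Event n Payload Client → NodeState Payload Client
  | .idle => s
  | .receive r =>
      if Valid cfg signed s.log s.epoch r ∧ r ∉ s.received then
        { s with
          received := s.received ++ [r]
          pending := s.pending ∪ {r} }
      else s
  | .propose I sn =>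
      { s with
        proposed := Function.update s.proposed sn (some (cutBatch cfg signed s I))
        pending := s.pending \ {r | r ∈ cutBatch cfg signed s I} }
  | .sbDeliver _ sn (some b) =>
      { s with
        log := Function.update s.log sn (some (some b))
        pending := s.pending \ {r | r ∈ b} }
  | .sbDeliver _ sn none =>
      { s with
        log := Function.update s.log sn (some none)
        pending := s.pending ∪ {r | ∃ b, s.proposed sn = some b ∧ r ∈ b} }
  | .advance =>
      { s with
        epoch := s.epoch + 1
        log := fillSkipped cfg s.log (s.epoch + 1) }
  | .deliver =>
      { s with
        firstUndelivered := s.firstUndelivered + 1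
        totalDelivered := s.totalDelivered +
          (match s.log s.firstUndelivered with
          | some (some b) => b.length
          | _ => 0) }

/-- The events that a node has to execute eventually if they stay enabled. -/
def Event.IsInternal : Event n Payload Client → Prop
  | .propose _ _ => True
  | .advance => True
  | .deliver => True
  | _ => False

end Algorithm

/-! ### Sequenced broadcast, failure detector, state machine replication -/

section Abstractions

/-- What happens at the nodes in one instance of sequenced broadcast with messages of type `Msg`:
`active t p` says that at time `t` the instance runs at `p`, having been initialized at `p` at that
time or before; `cast t sn m` says that the sender sb-casts `(sn, m)` at time `t`; `deliver t p sn v`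
says that `p` sb-delivers `(sn, v)` at time `t`, with `v = none` for `⊥`. -/
structure SBTrace (n : ℕ) (Msg : Type*) where
  active : ℕ → Fin n → Prop
  cast : ℕ → ℕ → Msg → Prop
  deliver : ℕ → Fin n → ℕ → Option Msg → Prop

/-- The specification of the instance `SB(σ, S, M, D)` of sequenced broadcast. Here `suspects t p`
is the list of suspects of the failure detector module of `p` at time `t`. -/
structure IsSB {n : ℕ} {Msg : Type*} (correct : Finset (Fin n))
    (suspects : ℕ → Fin n → Set (Fin n)) (σ : Fin n) (S : Set ℕ) (M : Set Msg)
    (T : SBTrace n Msg) : Prop where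
  /-- correct nodes sb-deliver only pairs in `S × (M ∪ {⊥})` -/
  domain : ∀ t, ∀ p ∈ correct, ∀ sn v, T.deliver t p sn v → sn ∈ S ∧ ∀ m, v = some m → m ∈ M
  /-- correct nodes sb-deliver at most once for every sequence number -/
  once : ∀ t t', ∀ p ∈ correct, ∀ sn v v', T.deliver t p sn v → T.deliver t' p sn v' → t = t'
  integrity : σ ∈ correct → ∀ t, ∀ p ∈ correct, ∀ sn m, T.deliver t p sn (some m) →
    ∃ t', T.cast t' sn m
  agreement : ∀ t t', ∀ p ∈ correct, ∀ q ∈ correct, ∀ sn v v',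
    T.deliver t p sn v → T.deliver t' q sn v' → v = v'
  /-- provided that all correct nodes initialize the instance -/
  termination : (∀ q ∈ correct, ∃ t, T.active t q) →
    ∀ p ∈ correct, ∀ sn ∈ S, ∃ t v, T.deliver t p sn v
  eventualProgress : ∀ t, ∀ p ∈ correct, ∀ sn ∈ S, T.deliver t p sn none →
    ∃ q ∈ correct, ∃ t₀ t₁, t₀ ≤ t₁ ∧ T.active t₀ q ∧ σ ∈ suspects t₁ q

/-- There is a time after which some correct node is never suspected by any correct node. -/
def EventualWeakAccuracy {n : ℕ} (correct : Finset (Fin n))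
    (suspects : ℕ → Fin n → Set (Fin n)) : Prop :=
  ∃ p ∈ correct, ∃ t₀, ∀ t ≥ t₀, ∀ q ∈ correct, p ∉ suspects t q

variable {n : ℕ} {Payload : Type u} {Client : Type v}

/-- SMR Integrity. Here `delivers p s r` says that `p` delivers `(s, r)`, and `bcast c` is the set
of requests that the client `c` broadcasts. -/
def SMRIntegrity (correct : Finset (Fin n)) (correctClients : Set Client)
    (bcast : Client → Set (Request Payload Client))
    (delivers : Fin n → ℕ → Request Payload Client → Prop) : Prop :=
  ∀ p ∈ correct, ∀ s r, delivers p s r → r.client ∈ correctClients → r ∈ bcast r.client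

/-- SMR Agreement. -/
def SMRAgreement (correct : Finset (Fin n))
    (delivers : Fin n → ℕ → Request Payload Client → Prop) : Prop :=
  ∀ p ∈ correct, ∀ q ∈ correct, ∀ s r r', delivers p s r → delivers q s r' → r = r'

/-- SMR Totality. -/
def SMRTotality (correct : Finset (Fin n))
    (delivers : Fin n → ℕ → Request Payload Client → Prop) : Prop :=
  ∀ p ∈ correct, ∀ s r, delivers p s r → ∀ q ∈ correct, delivers q s r

/-- SMR Liveness. -/
def SMRLiveness (correct : Finset (Fin n)) (correctClients : Set Client)
    (bcast : Client → Set (Request Payload Client))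
    (delivers : Fin n → ℕ → Request Payload Client → Prop) : Prop :=
  ∀ c ∈ correctClients, ∀ r ∈ bcast c, ∃ p ∈ correct, ∃ s, delivers p s r

end Abstractions

/-! ### Executions -/

section Executions

variable {n : ℕ} {Payload : Type u} {Client : Type v}

/-- The data of an infinite execution. Time is discrete, and every node executes one event per
time unit (possibly `idle`). The entries for faulty nodes and clients have no meaning. -/
structure Execution (n : ℕ) (Payload : Type u) (Client : Type v) where
  correct : Finset (Fin n)
  correctClients : Set Client
  /-- the requests that a client broadcasts -/
  bcast : Client → Set (Request Payload Client)
  /-- the requests for which a valid signature of their client is produced -/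
  signed : Set (Request Payload Client)
  /-- the lists of suspects of the failure detector -/
  suspects : ℕ → Fin n → Set (Fin n)
  state : ℕ → Fin n → NodeState Payload Client
  event : ℕ → Fin n → Event n Payload Client

/-- Node `p` delivers `(s, r)`: it delivers a batch that contains `r`, and `s` is the total number
of requests in the earlier batches plus the position (counted from `0`) of `r` in the batch. -/
def Execution.Delivers (X : Execution n Payload Client) (p : Fin n) (s : ℕ)
    (r : Request Payload Client) : Prop :=
  ∃ t, X.event t p = .deliver ∧
    ∃ b, (X.state t p).log (X.state t p).firstUndelivered = some (some b) ∧
      ∃ k, b[k]? = some r ∧ s = (X.state t p).totalDelivered + k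

/-- The correct nodes execute the ISS algorithm (with weak fairness: no internal event stays
enabled forever without being executed). -/
structure Execution.NodesFollowISS (X : Execution n Payload Client) (cfg : Config n Client) :
    Prop where
  init : ∀ p ∈ X.correct, X.state 0 p = initialState cfg
  enabled : ∀ t, ∀ p ∈ X.correct, Enabled cfg X.signed p (X.state t p) (X.event t p)
  step : ∀ t, ∀ p ∈ X.correct, X.state (t + 1) p = next cfg X.signed (X.state t p) (X.event t p)
  fair : ∀ p ∈ X.correct, ∀ a : Event n Payload Client, a.IsInternal →
    ∀ t, ∃ t' ≥ t, X.event t' p = a ∨ ¬ Enabled cfg X.signed p (X.state t' p) a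

/-- The behaviour of the correct clients: signatures of correct clients exist on exactly the
requests that they broadcast, request identifiers are unique, the timestamps used by a client are
contiguous, and a request is transmitted to all nodes again and again until it is delivered. -/
structure Execution.ClientsCorrect (X : Execution n Payload Client) (cfg : Config n Client) :
    Prop where
  member : X.correctClients ⊆ cfg.clients
  own : ∀ c ∈ X.correctClients, ∀ r ∈ X.bcast c, r.client = c
  sign : ∀ c ∈ X.correctClients, ∀ r ∈ X.bcast c, r ∈ X.signed
  unforgeable : ∀ r ∈ X.signed, r.client ∈ X.correctClients → r ∈ X.bcast r.client
  unique : ∀ c ∈ X.correctClients, ∀ r ∈ X.bcast c, ∀ r' ∈ X.bcast c, r.ts = r'.ts → r = r'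
  contiguous : ∀ c ∈ X.correctClients, ∀ r ∈ X.bcast c, ∀ t < r.ts, ∃ r' ∈ X.bcast c, r'.ts = t
  transmit : ∀ c ∈ X.correctClients, ∀ r ∈ X.bcast c,
    (∃ q ∈ X.correct, ∃ s, X.Delivers q s r) ∨
      ∀ p ∈ X.correct, ∀ t, ∃ t' ≥ t, X.event t' p = .receive r

/-- What happens in the execution in the instance of sequenced broadcast of the segment `I`. -/
def Execution.sbTrace (X : Execution n Payload Client) (cfg : Config n Client)
    (I : Segment n Payload Client) : SBTrace n (Batch Payload Client) where
  active t p := I ∈ (X.state t p).segments cfg X.signed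
  cast t sn b := X.event t I.leader = .propose I sn ∧
    b = cutBatch cfg X.signed (X.state t I.leader) I
  deliver t p sn v := X.event t p = .sbDeliver I sn v

end Executions

end

end ISS

namespace ISS

/-! ### Leaders, segments and validity of an epoch depend only on the log below it -/

section Dependence

variable {n : ℕ} {Payload : Type u} {Client : Type v} {cfg : Config n Client}

/-! Everything a node computes for an epoch is a function of its log below that epoch. Two correct
nodes with the same log prefix therefore compute the same segments and run the same instances of
sequenced broadcast, and SB agreement extends the common prefix by one more epoch (`log_agreement`).
Once all correct nodes have entered an epoch, SB termination fills it at each of them and fairness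
moves them on (`exists_epoch`). So there is a final log `G` to which all correct logs converge, and
every correct node delivers exactly the requests of `G`, numbered by their offsets (`delivers_iff`).
Integrity, agreement and totality are read off from `G`; for integrity, the messages of an instance
contain only signed requests.

Liveness needs a correct node that fails only finitely often and leads all late epochs. The node
spared by the failure detector fails only finitely often, by eventual progress. Under SIMPLE it
always leads, and under BACKOFF its penalty drops to zero or below for good. Under BLACKLIST it may
itself stay banned forever, but then another correct node does the job: if every reliable correct
node were blacklisted at a late epoch, all correct nodes would be, whereas at most `f` nodes are
(`exists_stable_leader_blacklist`).

Consider an undelivered request of a correct client with least timestamp. The low watermark of the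
client sticks at this timestamp, so the request is valid in all late epochs (`eventually_valid`),
and the stable leader receives it. The rotation of buckets hands its bucket to this leader
infinitely often, and since `L ≥ n` the leader proposes there each time. Batches are cut in order of
reception and nothing returns to the queues of a node that no longer fails, so each such proposal
removes one of the finitely many requests received up to a fixed time. This cannot go on forever
(`exists_mem_final`). -/

theorem mem_seqNrs {e sn : ℕ} :
    sn ∈ seqNrs cfg e ↔ e * cfg.epochLength ≤ sn ∧ sn < (e + 1) * cfg.epochLength := by
  simp [seqNrs]

theorem div_eq_of_mem_seqNrs {e sn : ℕ} (h : sn ∈ seqNrs cfg e) : sn / cfg.epochLength = e := by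
  rw [mem_seqNrs] at h
  exact Nat.div_eq_of_lt_le h.1 h.2

theorem leaderOf_congr {hist hist' : ℕ → List (Fin n)} {e sn : ℕ}
    (hh : ∀ k < e, hist k = hist' k) (hsn : sn < e * cfg.epochLength) :
    leaderOf cfg hist sn = leaderOf cfg hist' sn := by
  have h : sn / cfg.epochLength < e := Nat.div_lt_of_lt_mul (by rwa [mul_comm])
  simp only [leaderOf, hh _ h]

theorem lastFailure_congr {hist hist' : ℕ → List (Fin n)} {log log' : Log Payload Client} {e : ℕ}
    (hh : ∀ k < e, hist k = hist' k) (hl : ∀ sn < e * cfg.epochLength, log sn = log' sn)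
    (i : Fin n) : lastFailure cfg hist log i e = lastFailure cfg hist' log' i e := by
  classical
  unfold lastFailure
  congr 1
  apply Finset.filter_congr
  intro sn hsn
  rw [Finset.mem_range] at hsn
  rw [leaderOf_congr hh hsn, hl sn hsn]

theorem penalty_congr {hist hist' : ℕ → List (Fin n)} {log log' : Log Payload Client} {e : ℕ}
    (hh : ∀ k < e, hist k = hist' k) (hl : ∀ sn < e * cfg.epochLength, log sn = log' sn)
    (i : Fin n) : penalty cfg hist log i e = penalty cfg hist' log' i e := by
  induction e with
  | zero => rfl
  | succ e ih =>
    have h1 := ih (fun k hk => hh k (by omega))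
      (fun sn hsn => hl sn (hsn.trans_le (Nat.mul_le_mul_right _ (Nat.le_succ e))))
    have h2 : suspect cfg hist log i e = suspect cfg hist' log' i e := by
      unfold suspect
      rw [lastFailure_congr hh hl]
    simp only [penalty, h1]
    classical exact if_congr (iff_of_eq h2) rfl rfl

theorem blacklisted_congr {hist hist' : ℕ → List (Fin n)} {log log' : Log Payload Client} {e : ℕ}
    (hh : ∀ k < e, hist k = hist' k) (hl : ∀ sn < e * cfg.epochLength, log sn = log' sn)
    (i : Fin n) : Blacklisted cfg hist log i e = Blacklisted cfg hist' log' i e := by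
  unfold Blacklisted
  simp only [lastFailure_congr hh hl]

theorem policyLeaders_congr {hist hist' : ℕ → List (Fin n)} {log log' : Log Payload Client} {e : ℕ}
    (hh : ∀ k < e, hist k = hist' k) (hl : ∀ sn < e * cfg.epochLength, log sn = log' sn) :
    policyLeaders cfg hist log e = policyLeaders cfg hist' log' e := by
  unfold policyLeaders
  cases cfg.policy
  · rfl
  · simp only [penalty_congr hh hl]
  · refine List.filter_congr fun i _ => decide_eq_decide.mpr ?_
    rw [blacklisted_congr hh hl]

theorem leaderHistory_congr {log log' : Log Payload Client} {e : ℕ}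
    (hl : ∀ sn < e * cfg.epochLength, log sn = log' sn) :
    leaderHistory cfg log e = leaderHistory cfg log' e := by
  induction e with
  | zero => rfl
  | succ e ih =>
    have hl' : ∀ sn < e * cfg.epochLength, log sn = log' sn := fun sn hsn =>
      hl sn (hsn.trans_le (Nat.mul_le_mul_right _ (Nat.le_succ e)))
    simp only [leaderHistory, ih hl',
      policyLeaders_congr (hist := leaderHistory cfg log' e) (fun _ _ => rfl) hl']

theorem leaders_congr {log log' : Log Payload Client} {e : ℕ}
    (hl : ∀ sn < e * cfg.epochLength, log sn = log' sn) :
    leaders cfg log e = leaders cfg log' e := by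
  unfold leaders
  rw [leaderHistory_congr hl, policyLeaders_congr (fun _ _ => rfl) hl]

theorem leaderHistory_apply (log : Log Payload Client) {e k : ℕ} (hk : k < e) :
    leaderHistory cfg log e k = leaders cfg log k := by
  induction e with
  | zero => omega
  | succ e ih =>
    simp only [leaderHistory]
    by_cases h : k = e
    · subst h
      rw [Function.update_self, leaders]
    · rw [Function.update_of_ne h, ih (by omega)]

/-- Replaces the truncated histories of the recursion by one history for all epochs, so that
failures and penalties of different epochs can be compared. -/
theorem leaders_eq_policyLeaders (log : Log Payload Client) (e : ℕ) :
    leaders cfg log e = policyLeaders cfg (leaders cfg log) log e :=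
  policyLeaders_congr (fun _ hk => leaderHistory_apply log hk) (fun _ _ => rfl)

theorem nodup_leaders (log : Log Payload Client) (e : ℕ) : (leaders cfg log e).Nodup := by
  unfold leaders policyLeaders
  cases cfg.policy
  · exact List.nodup_finRange n
  · exact (List.nodup_finRange n).filter _
  · exact (List.nodup_finRange n).filter _

theorem lowWatermark_congr {log log' : Log Payload Client} {e : ℕ}
    (hl : ∀ sn < e * cfg.epochLength, log sn = log' sn) (c : Client) :
    lowWatermark cfg log e c = lowWatermark cfg log' e c := by
  unfold lowWatermark
  congr 1
  ext t
  exact forall₂_congr fun sn hsn => by rw [hl sn hsn]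

theorem valid_congr {signed : Set (Request Payload Client)} {log log' : Log Payload Client} {e : ℕ}
    (hl : ∀ sn < e * cfg.epochLength, log sn = log' sn) (r : Request Payload Client) :
    Valid cfg signed log e r ↔ Valid cfg signed log' e r := by
  unfold Valid
  rw [lowWatermark_congr hl]

/-- An SB instance is identified by its whole segment, including the message set. This equality is
what puts two nodes with the same prefix into literally the same instance. -/
theorem segments_congr {signed : Set (Request Payload Client)} {log log' : Log Payload Client}
    {e : ℕ} (hl : ∀ sn < e * cfg.epochLength, log sn = log' sn) :
    segments cfg signed log e = segments cfg signed log' e := by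
  have hb : batches cfg signed log e = batches cfg signed log' e := by
    funext B
    unfold batches
    simp only [valid_congr hl]
  unfold segments
  rw [leaders_congr hl, hb]

theorem seqNrs_of_mem_segments {signed : Set (Request Payload Client)} {log : Log Payload Client}
    {e sn : ℕ} {I : Segment n Payload Client} (hI : I ∈ segments cfg signed log e)
    (hsn : sn ∈ I.seqNrs) : sn ∈ seqNrs cfg e := by
  obtain ⟨l, hl, rfl⟩ := hI
  exact hsn.1

theorem eq_of_mem_segments {signed : Set (Request Payload Client)} {log : Log Payload Client}
    {e sn : ℕ} {I J : Segment n Payload Client} (hI : I ∈ segments cfg signed log e)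
    (hJ : J ∈ segments cfg signed log e) (hsn : sn ∈ I.seqNrs) (hsn' : sn ∈ J.seqNrs) : I = J := by
  obtain ⟨l, hl, rfl⟩ := hI
  obtain ⟨l', hl', rfl⟩ := hJ
  obtain rfl : l = l' := hsn.2.symm.trans hsn'.2
  rfl

theorem leaders_ne_nil_of_mem_segments {signed : Set (Request Payload Client)}
    {log : Log Payload Client} {e : ℕ} {I : Segment n Payload Client}
    (hI : I ∈ segments cfg signed log e) : leaders cfg log e ≠ [] := by
  obtain ⟨l, hl, rfl⟩ := hI
  exact List.ne_nil_of_length_pos (by omega)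

theorem epoch_of_mem_segments {signed : Set (Request Payload Client)}
    {log : Log Payload Client} {e : ℕ} {I : Segment n Payload Client}
    (hI : I ∈ segments cfg signed log e) : I.epoch = e := by
  obtain ⟨l, hl, rfl⟩ := hI
  rfl

theorem exists_mem_segments (signed : Set (Request Payload Client)) {log : Log Payload Client}
    {e sn : ℕ} (h : leaders cfg log e ≠ []) (hsn : sn ∈ seqNrs cfg e) :
    ∃ I ∈ segments cfg signed log e, sn ∈ I.seqNrs :=
  ⟨_, ⟨sn % (leaders cfg log e).length, Nat.mod_lt _ (List.length_pos_of_ne_nil h), rfl⟩, hsn, rfl⟩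

/-- The leader of the segment containing `sn` is the node responsible for `sn`. -/
theorem leaderOf_of_mem_segments {signed : Set (Request Payload Client)} {log : Log Payload Client}
    {e sn : ℕ} {I : Segment n Payload Client} (hI : I ∈ segments cfg signed log e)
    (hsn : sn ∈ I.seqNrs) : leaderOf cfg (leaders cfg log) sn = some I.leader := by
  have h := div_eq_of_mem_seqNrs (seqNrs_of_mem_segments hI hsn)
  obtain ⟨l, hl, rfl⟩ := hI
  simp only [leaderOf, h]
  obtain ⟨-, h2⟩ := hsn
  simp only [h2]
  exact List.getElem?_eq_getElem hl

theorem fillSkipped_of_lt {log : Log Payload Client} {e sn : ℕ} (h : sn < e * cfg.epochLength) :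
    fillSkipped cfg log e sn = log sn := by
  unfold fillSkipped
  rw [if_neg]
  rintro ⟨-, h'⟩
  rw [mem_seqNrs] at h'
  omega

theorem leaders_fillSkipped (log : Log Payload Client) (e : ℕ) :
    leaders cfg (fillSkipped cfg log e) e = leaders cfg log e :=
  leaders_congr fun _ => fillSkipped_of_lt

end Dependence

/-! ### Logs of correct nodes: shape, persistence, agreement and convergence -/

section Runs

variable {n : ℕ} {Payload : Type u} {Client : Type v}

/-- In the execution `X`, the correct nodes execute ISS on top of instances of sequenced broadcast
that satisfy their specification. -/
structure Execution.IsRun (X : Execution n Payload Client) (cfg : Config n Client) : Prop where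
  nodes : X.NodesFollowISS cfg
  sb : ∀ I : Segment n Payload Client,
    IsSB X.correct X.suspects I.leader I.seqNrs I.msgs (X.sbTrace cfg I)

variable {cfg : Config n Client} {X : Execution n Payload Client} {p q : Fin n} {t : ℕ}

/-- The effect of a step on the epoch and the log of a correct node. -/
theorem Execution.IsRun.step_cases (h : X.IsRun cfg) (hp : p ∈ X.correct) (t : ℕ) :
    ((X.state (t + 1) p).epoch = (X.state t p).epoch ∧
      (X.state (t + 1) p).log = (X.state t p).log) ∨
    (∃ I sn v, X.event t p = .sbDeliver I sn v ∧
      I ∈ segments cfg X.signed (X.state t p).log (X.state t p).epoch ∧ sn ∈ I.seqNrs ∧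
      (X.state (t + 1) p).epoch = (X.state t p).epoch ∧
      (X.state (t + 1) p).log = Function.update (X.state t p).log sn (some v)) ∨
    (X.event t p = .advance ∧
      (∀ sn ∈ seqNrs cfg (X.state t p).epoch, (X.state t p).log sn ≠ none) ∧
      (X.state (t + 1) p).epoch = (X.state t p).epoch + 1 ∧
      (X.state (t + 1) p).log = fillSkipped cfg (X.state t p).log ((X.state t p).epoch + 1)) := by
  have hs := h.nodes.step t p hp
  have he := h.nodes.enabled t p hp
  rcases ha : X.event t p with _ | r | ⟨I, sn⟩ | ⟨I, sn, _ | b⟩ | _ | _ <;> rw [ha] at hs he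
  · left; rw [hs]; exact ⟨rfl, rfl⟩
  · left; rw [hs]; simp only [next]; split_ifs <;> exact ⟨rfl, rfl⟩
  · left; rw [hs]; exact ⟨rfl, rfl⟩
  · right; left
    refine ⟨I, sn, none, rfl, he, ((h.sb I).domain t p hp sn none ha).1, ?_⟩
    rw [hs]; exact ⟨rfl, rfl⟩
  · right; left
    refine ⟨I, sn, some b, rfl, he, ((h.sb I).domain t p hp sn (some b) ha).1, ?_⟩
    rw [hs]; exact ⟨rfl, rfl⟩
  · right; right
    refine ⟨rfl, he, ?_⟩
    rw [hs]; exact ⟨rfl, rfl⟩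
  · left; rw [hs]; exact ⟨rfl, rfl⟩

/-- The entries of the current epoch change the log only above the previous epochs. -/
theorem update_of_mem_segments {signed : Set (Request Payload Client)} {log : Log Payload Client}
    {e sn : ℕ} {I : Segment n Payload Client} (hI : I ∈ segments cfg signed log e)
    (hsn : sn ∈ I.seqNrs) (v : Option (Option (Batch Payload Client))) :
    ∀ k < e * cfg.epochLength, Function.update log sn v k = log k := by
  intro k hk
  have := (mem_seqNrs.mp (seqNrs_of_mem_segments hI hsn)).1
  rw [Function.update_of_ne (by omega)]

/-- The log of a correct node is filled before its current epoch and empty after it. -/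
theorem Execution.IsRun.log_shape (h : X.IsRun cfg) (hp : p ∈ X.correct) (t : ℕ) :
    (∀ sn < (X.state t p).epoch * cfg.epochLength, (X.state t p).log sn ≠ none) ∧
    (∀ sn, ((X.state t p).epoch + 1) * cfg.epochLength ≤ sn → (X.state t p).log sn = none) ∧
    (leaders cfg (X.state t p).log (X.state t p).epoch = [] →
      ∀ sn ∈ seqNrs cfg (X.state t p).epoch, (X.state t p).log sn ≠ none) := by
  induction t with
  | zero =>
    rw [h.nodes.init p hp]
    refine ⟨fun sn hsn => by simp [initialState] at hsn, fun sn hsn => ?_, fun h0 sn hsn => ?_⟩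
    · simp only [initialState] at hsn ⊢
      simp only [fillSkipped]
      rw [if_neg]
      rintro ⟨-, h'⟩
      rw [mem_seqNrs] at h'
      omega
    · simp only [initialState] at h0 hsn ⊢
      rw [leaders_fillSkipped] at h0
      simp [fillSkipped, h0, hsn]
  | succ t ih =>
    obtain ⟨ih1, ih2, ih3⟩ := ih
    rcases h.step_cases hp t with ⟨he, hl⟩ | ⟨I, sn, v, -, hI, hsn, he, hl⟩ | ⟨-, hf, he, hl⟩
    · rw [he, hl]
      exact ⟨ih1, ih2, ih3⟩
    · have hm := mem_seqNrs.mp (seqNrs_of_mem_segments hI hsn)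
      rw [he, hl]
      refine ⟨fun k hk => ?_, fun k hk => ?_, fun h0 => ?_⟩
      · rw [update_of_mem_segments hI hsn _ k hk]
        exact ih1 k hk
      · rw [Function.update_of_ne (by omega)]
        exact ih2 k hk
      -- An sb-delivery presupposes a segment, hence a leader, so the epoch is not a skipped one.
      · rw [leaders_congr (update_of_mem_segments hI hsn _)] at h0
        exact absurd h0 (leaders_ne_nil_of_mem_segments hI)
    · rw [he, hl]
      refine ⟨fun k hk => ?_, fun k hk => ?_, fun h0 k hk => ?_⟩
      · rw [fillSkipped_of_lt hk]
        by_cases hk' : k < (X.state t p).epoch * cfg.epochLength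
        · exact ih1 k hk'
        · exact hf k (mem_seqNrs.mpr ⟨by omega, hk⟩)
      · simp only [fillSkipped]
        rw [if_neg]
        · exact ih2 k ((Nat.mul_le_mul_right _ (Nat.le_succ _)).trans hk)
        · rintro ⟨-, h'⟩
          rw [mem_seqNrs] at h'
          omega
      · rw [leaders_fillSkipped] at h0
        simp [fillSkipped, h0, hk]

/-- The entries of the current epoch of a correct node were sb-delivered in an instance of that
epoch, unless the epoch is skipped. -/
theorem Execution.IsRun.origin (h : X.IsRun cfg) (hp : p ∈ X.correct) (t sn : ℕ)
    (v : Option (Batch Payload Client)) (hsn : (X.state t p).epoch * cfg.epochLength ≤ sn)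
    (hv : (X.state t p).log sn = some v) :
    (leaders cfg (X.state t p).log (X.state t p).epoch = [] ∧ v = none) ∨
    ∃ t' < t, ∃ I ∈ segments cfg X.signed (X.state t p).log (X.state t p).epoch,
      sn ∈ I.seqNrs ∧ X.event t' p = .sbDeliver I sn v := by
  induction t with
  | zero =>
    rw [h.nodes.init p hp] at hv ⊢
    simp only [initialState, leaders_fillSkipped] at hv ⊢
    left
    simp only [fillSkipped] at hv
    split_ifs at hv with h'
    exact ⟨h'.1, (Option.some.inj hv).symm⟩
  | succ t ih =>
    rcases h.step_cases hp t with ⟨he, hl⟩ | ⟨I, k, w, ha, hI, hk, he, hl⟩ | ⟨-, -, he, hl⟩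
    · rw [he] at hsn
      rw [hl] at hv
      rw [he, hl]
      rcases ih hsn hv with h' | ⟨t', ht', h'⟩
      · exact Or.inl h'
      · exact Or.inr ⟨t', by omega, h'⟩
    · rw [he] at hsn
      rw [hl] at hv
      rw [he, hl, leaders_congr (update_of_mem_segments hI hk _),
        segments_congr (update_of_mem_segments hI hk _)]
      by_cases hks : sn = k
      · subst hks
        rw [Function.update_self] at hv
        obtain rfl := Option.some.inj hv
        exact Or.inr ⟨t, by omega, I, hI, hk, ha⟩
      · rw [Function.update_of_ne hks] at hv
        rcases ih hsn hv with h' | ⟨t', ht', h'⟩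
        · exact Or.inl h'
        · exact Or.inr ⟨t', by omega, h'⟩
    · rw [he] at hsn
      rw [hl] at hv
      rw [he, hl, leaders_fillSkipped]
      left
      -- Positions of the new epoch were empty before the advance, so an entry there can only come
      -- from skipping.
      have h0 := (h.log_shape hp t).2.1 sn hsn
      simp only [fillSkipped, h0] at hv
      split_ifs at hv with h'
      exact ⟨h'.1, (Option.some.inj hv).symm⟩

/-- Log entries are never overwritten: an earlier entry would stem from an sb-delivery in an
instance of the same epoch, the position determines the instance, and an instance delivers only once
per position. -/
theorem Execution.IsRun.log_eq_none_of_sbDeliver (h : X.IsRun cfg) (hp : p ∈ X.correct)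
    {I : Segment n Payload Client} {sn : ℕ} {v : Option (Batch Payload Client)}
    (ha : X.event t p = .sbDeliver I sn v) : (X.state t p).log sn = none := by
  have hI : I ∈ segments cfg X.signed (X.state t p).log (X.state t p).epoch := by
    have := h.nodes.enabled t p hp
    rwa [ha] at this
  have hsn := ((h.sb I).domain t p hp sn v ha).1
  by_contra hne
  obtain ⟨w, hw⟩ := Option.ne_none_iff_exists'.mp hne
  rcases h.origin hp t sn w (mem_seqNrs.mp (seqNrs_of_mem_segments hI hsn)).1 hw with
    ⟨h0, -⟩ | ⟨t', ht', J, hJ, hsn', ha'⟩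
  · exact leaders_ne_nil_of_mem_segments hI h0
  · obtain rfl := eq_of_mem_segments hI hJ hsn hsn'
    exact ht'.ne ((h.sb I).once t' t p hp sn w v ha' ha)

/-- A step of a correct node leaves an entry of the log unchanged, unless there was no entry and
the entry belongs to the new current epoch. -/
theorem Execution.IsRun.log_step (h : X.IsRun cfg) (hp : p ∈ X.correct) (t sn : ℕ) :
    (X.state (t + 1) p).log sn = (X.state t p).log sn ∨
    ((X.state t p).log sn = none ∧ (X.state (t + 1) p).epoch * cfg.epochLength ≤ sn) := by
  rcases h.step_cases hp t with ⟨he, hl⟩ | ⟨I, k, w, ha, hI, hk, he, hl⟩ | ⟨-, -, he, hl⟩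
  · exact Or.inl (by rw [hl])
  · by_cases hks : sn = k
    · subst hks
      right
      refine ⟨h.log_eq_none_of_sbDeliver hp ha, ?_⟩
      rw [he]
      exact (mem_seqNrs.mp (seqNrs_of_mem_segments hI hk)).1
    · left
      rw [hl, Function.update_of_ne hks]
  · by_cases hlt : sn < ((X.state t p).epoch + 1) * cfg.epochLength
    · left
      rw [hl, fillSkipped_of_lt hlt]
    · right
      rw [he]
      exact ⟨(h.log_shape hp t).2.1 sn (by omega), by omega⟩

theorem Execution.IsRun.log_persist (h : X.IsRun cfg) (hp : p ∈ X.correct) {t t' : ℕ} (ht : t ≤ t')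
    {sn : ℕ} {v : Option (Batch Payload Client)} (hv : (X.state t p).log sn = some v) :
    (X.state t' p).log sn = some v := by
  induction t', ht using Nat.le_induction with
  | base => exact hv
  | succ t' _ ih =>
    rcases h.log_step hp t' sn with h' | ⟨h', -⟩
    · rw [h', ih]
    · rw [ih] at h'
      cases h'

theorem Execution.IsRun.log_sbDeliver (h : X.IsRun cfg) (hp : p ∈ X.correct)
    {I : Segment n Payload Client} {sn : ℕ} {v : Option (Batch Payload Client)}
    (ha : X.event t p = .sbDeliver I sn v) : (X.state (t + 1) p).log sn = some v := by
  rw [h.nodes.step t p hp, ha]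
  cases v <;> simp [next]

/-- Every log entry of a correct node was already there in the epoch to which it belongs. -/
theorem Execution.IsRun.exists_log_epoch (h : X.IsRun cfg) (hp : p ∈ X.correct) {t sn : ℕ}
    {v : Option (Batch Payload Client)} (hv : (X.state t p).log sn = some v) :
    ∃ t' ≤ t, (X.state t' p).log sn = some v ∧ sn ∈ seqNrs cfg (X.state t' p).epoch := by
  suffices H : ∃ t' ≤ t, (X.state t' p).log sn = some v ∧
      (X.state t' p).epoch * cfg.epochLength ≤ sn by
    obtain ⟨t', ht', hv', hsn⟩ := H
    refine ⟨t', ht', hv', mem_seqNrs.mpr ⟨hsn, ?_⟩⟩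
    by_contra hlt
    rw [(h.log_shape hp t').2.1 sn (by omega)] at hv'
    cases hv'
  induction t with
  | zero =>
    refine ⟨0, le_rfl, hv, ?_⟩
    rw [h.nodes.init p hp]
    simp [initialState]
  | succ t ih =>
    rcases h.log_step hp t sn with h' | ⟨-, h'⟩
    · obtain ⟨t', ht', h''⟩ := ih (h' ▸ hv)
      exact ⟨t', by omega, h''⟩
    · exact ⟨t + 1, le_rfl, hv, h'⟩

/-- The logs of correct nodes agree. -/
theorem Execution.IsRun.log_agreement (h : X.IsRun cfg) (hp : p ∈ X.correct) (hq : q ∈ X.correct)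
    {t t' sn : ℕ} {v v' : Option (Batch Payload Client)} (hv : (X.state t p).log sn = some v)
    (hv' : (X.state t' q).log sn = some v') : v = v' := by
  -- Agreement within an epoch needs agreement on the entire prefix, hence an induction over epochs
  -- that quantifies over nodes and times.
  suffices H : ∀ e, ∀ p ∈ X.correct, ∀ q ∈ X.correct, ∀ t t', ∀ sn < e * cfg.epochLength, ∀ v v',
      (X.state t p).log sn = some v → (X.state t' q).log sn = some v' → v = v' by
    obtain ⟨t₀, -, -, h₀⟩ := h.exists_log_epoch hp hv
    exact H _ p hp q hq t t' sn (mem_seqNrs.mp h₀).2 v v' hv hv'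
  clear hv hv' hp hq
  intro e
  induction e with
  | zero => simp
  | succ e ih =>
    intro p hp q hq t t' sn hsn v v' hv hv'
    by_cases hlt : sn < e * cfg.epochLength
    · exact ih p hp q hq t t' sn hlt v v' hv hv'
    have he : sn / cfg.epochLength = e := div_eq_of_mem_seqNrs (mem_seqNrs.mpr ⟨by omega, hsn⟩)
    obtain ⟨t₁, -, hv₁, h₁⟩ := h.exists_log_epoch hp hv
    obtain ⟨t₂, -, hv₂, h₂⟩ := h.exists_log_epoch hq hv'
    have e₁ : (X.state t₁ p).epoch = e := (div_eq_of_mem_seqNrs h₁).symm.trans he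
    have e₂ : (X.state t₂ q).epoch = e := (div_eq_of_mem_seqNrs h₂).symm.trans he
    have hl : ∀ k < e * cfg.epochLength, (X.state t₁ p).log k = (X.state t₂ q).log k := by
      intro k hk
      obtain ⟨a, ha⟩ := Option.ne_none_iff_exists'.mp ((h.log_shape hp t₁).1 k (by rwa [e₁]))
      obtain ⟨b, hb⟩ := Option.ne_none_iff_exists'.mp ((h.log_shape hq t₂).1 k (by rwa [e₂]))
      rw [ha, hb, ih p hp q hq t₁ t₂ k hk a b ha hb]
    have o₁ := h.origin hp t₁ sn v (mem_seqNrs.mp h₁).1 hv₁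
    have o₂ := h.origin hq t₂ sn v' (mem_seqNrs.mp h₂).1 hv₂
    rw [e₁, leaders_congr hl, segments_congr hl] at o₁
    rw [e₂] at o₂
    -- With equal leaders, either both nodes skip the epoch or both values come from the same SB
    -- instance.
    rcases o₁ with ⟨hn, rfl⟩ | ⟨s₁, -, I, hI, hsI, ha⟩
    · rcases o₂ with ⟨-, rfl⟩ | ⟨s₂, -, J, hJ, -⟩
      · rfl
      · exact absurd hn (leaders_ne_nil_of_mem_segments hJ)
    · rcases o₂ with ⟨hn, -⟩ | ⟨s₂, -, J, hJ, hsJ, ha'⟩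
      · exact absurd hn (leaders_ne_nil_of_mem_segments hI)
      · obtain rfl := eq_of_mem_segments hI hJ hsI hsJ
        exact (h.sb I).agreement s₁ s₂ p hp q hq sn v v' ha ha'

/-! ### Progress -/

theorem Execution.IsRun.epoch_step (h : X.IsRun cfg) (hp : p ∈ X.correct) (t : ℕ) :
    (X.state (t + 1) p).epoch = (X.state t p).epoch ∨
    (X.state (t + 1) p).epoch = (X.state t p).epoch + 1 := by
  rcases h.step_cases hp t with ⟨he, -⟩ | ⟨I, k, w, -, -, -, he, -⟩ | ⟨-, -, he, -⟩
  · exact Or.inl he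
  · exact Or.inl he
  · exact Or.inr he

theorem Execution.IsRun.epoch_mono (h : X.IsRun cfg) (hp : p ∈ X.correct) {t t' : ℕ} (ht : t ≤ t') :
    (X.state t p).epoch ≤ (X.state t' p).epoch := by
  induction t', ht using Nat.le_induction with
  | base => exact le_rfl
  | succ t' _ ih => rcases h.epoch_step hp t' with h' | h' <;> omega

theorem Execution.IsRun.epoch_le (h : X.IsRun cfg) (hp : p ∈ X.correct) (t : ℕ) :
    (X.state t p).epoch ≤ t := by
  induction t with
  | zero => rw [h.nodes.init p hp]; simp [initialState]
  | succ t ih => rcases h.epoch_step hp t with h' | h' <;> omega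

theorem Execution.IsRun.log_congr (h : X.IsRun cfg) (hp : p ∈ X.correct) (hq : q ∈ X.correct)
    {t t' : ℕ} (he : (X.state t p).epoch ≤ (X.state t' q).epoch) :
    ∀ k < (X.state t p).epoch * cfg.epochLength, (X.state t p).log k = (X.state t' q).log k := by
  intro k hk
  obtain ⟨a, ha⟩ := Option.ne_none_iff_exists'.mp ((h.log_shape hp t).1 k hk)
  obtain ⟨b, hb⟩ := Option.ne_none_iff_exists'.mp
    ((h.log_shape hq t').1 k (hk.trans_le (Nat.mul_le_mul_right _ he)))
  rw [ha, hb, h.log_agreement hp hq ha hb]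

/-- If all correct nodes enter an epoch, then they fill the log positions of the epoch. -/
theorem Execution.IsRun.exists_log (h : X.IsRun cfg) {e : ℕ}
    (he : ∀ q ∈ X.correct, ∃ t, (X.state t q).epoch = e) (hp : p ∈ X.correct) {sn : ℕ}
    (hsn : sn ∈ seqNrs cfg e) : ∃ t v, (X.state t p).log sn = some v := by
  obtain ⟨t, rfl⟩ := he p hp
  by_cases h0 : leaders cfg (X.state t p).log (X.state t p).epoch = []
  · exact ⟨t, Option.ne_none_iff_exists'.mp ((h.log_shape hp t).2.2 h0 sn hsn)⟩
  · obtain ⟨I, hI, hsI⟩ := exists_mem_segments X.signed h0 hsn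
    -- Termination requires all correct nodes to run this very instance; they do, since their
    -- prefixes agree.
    obtain ⟨t', v, ha⟩ := (h.sb I).termination (fun q hq => by
      obtain ⟨t', ht'⟩ := he q hq
      refine ⟨t', ?_⟩
      simp only [Execution.sbTrace, NodeState.segments]
      rw [ht', ← segments_congr (h.log_congr hp hq ht'.ge)]
      exact hI) p hp sn hsI
    exact ⟨t' + 1, v, h.log_sbDeliver hp ha⟩

/-- Every correct node enters every epoch. -/
theorem Execution.IsRun.exists_epoch (h : X.IsRun cfg) (hp : p ∈ X.correct) (e : ℕ) :
    ∃ t, (X.state t p).epoch = e := by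
  induction e generalizing p with
  | zero => exact ⟨0, by rw [h.nodes.init p hp]; rfl⟩
  | succ e ih =>
    obtain ⟨t₀, ht₀⟩ := ih hp
    have h1 : ∀ sn ∈ seqNrs cfg e, ∃ t, ∀ t' ≥ t, (X.state t' p).log sn ≠ none := by
      intro sn hsn
      obtain ⟨t, v, hv⟩ := h.exists_log (fun q hq => ih hq) hp hsn
      exact ⟨t, fun t' ht' => by rw [h.log_persist hp ht' hv]; simp⟩
    choose! T hT using h1
    by_contra! hne
    have h2 : ∀ t ≥ t₀, (X.state t p).epoch = e := by
      intro t ht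
      induction t, ht using Nat.le_induction with
      | base => exact ht₀
      | succ t _ ih' =>
        have := hne (t + 1)
        rcases h.epoch_step hp t with h' | h' <;> omega
    -- A node stuck in epoch `e` has all entries of `e` from this time on, so advancing stays
    -- enabled and fairness forces it.
    obtain ⟨t, ht, h3⟩ := h.nodes.fair p hp .advance trivial (max t₀ ((seqNrs cfg e).sup T))
    have h4 := h2 t (le_of_max_le_left ht)
    rcases h3 with h3 | h3
    · have h5 := h.nodes.step t p hp
      rw [h3] at h5
      apply hne (t + 1)
      rw [h5]
      simp [next, h4]
    · apply h3
      simp only [Enabled, h4]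
      exact fun sn hsn => hT sn hsn t ((Finset.le_sup hsn).trans (le_of_max_le_right ht))

/-- `G` is the log on which the correct nodes eventually agree. -/
structure Execution.IsFinalLog (X : Execution n Payload Client)
    (G : ℕ → Option (Batch Payload Client)) : Prop where
  eventually : ∀ p ∈ X.correct, ∀ sn, ∃ T, ∀ t ≥ T, (X.state t p).log sn = some (G sn)
  eq : ∀ p ∈ X.correct, ∀ t sn v, (X.state t p).log sn = some v → v = G sn

/-- Nonempty epochs cover all positions, and each is filled since every epoch is entered. The
entries of one correct node define `G`; agreement transfers them to the others. -/
theorem Execution.IsRun.exists_isFinalLog (h : X.IsRun cfg) (hL : 1 ≤ cfg.epochLength)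
    (hp : p ∈ X.correct) : ∃ G, X.IsFinalLog G := by
  have h1 : ∀ q ∈ X.correct, ∀ sn, ∃ t v, (X.state t q).log sn = some v := fun q hq sn =>
    h.exists_log (fun q hq => h.exists_epoch hq (sn / cfg.epochLength)) hq
      (mem_seqNrs.mpr ⟨Nat.div_mul_le_self _ _, by
        rw [mul_comm]; exact Nat.lt_mul_div_succ sn hL⟩)
  choose T G hG using h1 p hp
  refine ⟨G, fun q hq sn => ?_, fun q hq t sn v hv => h.log_agreement hq hp hv (hG sn)⟩
  obtain ⟨t, v, hv⟩ := h1 q hq sn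
  exact ⟨t, fun t' ht' => by
    rw [h.log_persist hq ht' hv, h.log_agreement hq hp hv (hG sn)]⟩

end Runs

/-! ### Delivery from the final log, and the three safety properties -/

section Delivery

variable {n : ℕ} {Payload : Type u} {Client : Type v}

/-- The number of requests of a log entry. -/
def entrySize (v : Option (Batch Payload Client)) : ℕ := v.elim 0 List.length

/-- The number of requests in the entries of a complete log before `sn`. -/
def requestOffset (G : ℕ → Option (Batch Payload Client)) (sn : ℕ) : ℕ :=
  ∑ i ∈ Finset.range sn, entrySize (G i)

theorem requestOffset_succ (G : ℕ → Option (Batch Payload Client)) (sn : ℕ) :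
    requestOffset G (sn + 1) = requestOffset G sn + entrySize (G sn) :=
  Finset.sum_range_succ _ _

theorem requestOffset_mono (G : ℕ → Option (Batch Payload Client)) : Monotone (requestOffset G) :=
  monotone_nat_of_le_succ fun sn => by rw [requestOffset_succ]; omega

/-- The intervals of request numbers occupied by different log positions are disjoint. -/
theorem requestOffset_inj {G : ℕ → Option (Batch Payload Client)} {sn sn' k k' : ℕ}
    (hk : k < entrySize (G sn)) (hk' : k' < entrySize (G sn'))
    (h : requestOffset G sn + k = requestOffset G sn' + k') : sn = sn' ∧ k = k' := by
  rcases lt_trichotomy sn sn' with hlt | rfl | hlt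
  · have := requestOffset_mono G (Nat.succ_le_of_lt hlt)
    rw [Nat.succ_eq_add_one, requestOffset_succ] at this
    omega
  · exact ⟨rfl, by omega⟩
  · have := requestOffset_mono G (Nat.succ_le_of_lt hlt)
    rw [Nat.succ_eq_add_one, requestOffset_succ] at this
    omega

/-- The log with the entries `G`. -/
def finalLog (G : ℕ → Option (Batch Payload Client)) : Log Payload Client := fun sn => some (G sn)

variable {cfg : Config n Client} {X : Execution n Payload Client} {p q : Fin n} {t : ℕ}
  {G : ℕ → Option (Batch Payload Client)}

theorem Execution.IsRun.log_eq_finalLog (h : X.IsRun cfg) (hG : X.IsFinalLog G)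
    (hp : p ∈ X.correct) (t : ℕ) :
    ∀ k < (X.state t p).epoch * cfg.epochLength, (X.state t p).log k = finalLog G k := by
  intro k hk
  obtain ⟨v, hv⟩ := Option.ne_none_iff_exists'.mp ((h.log_shape hp t).1 k hk)
  rw [hv, hG.eq p hp t k v hv, finalLog]

theorem Execution.IsRun.segments_eq (h : X.IsRun cfg) (hG : X.IsFinalLog G)
    (hp : p ∈ X.correct) (t : ℕ) : (X.state t p).segments cfg X.signed =
      segments cfg X.signed (finalLog G) (X.state t p).epoch :=
  segments_congr (h.log_eq_finalLog hG hp t)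

/-- The origin of the entries of the final log. -/
theorem Execution.IsRun.final_origin (h : X.IsRun cfg) (hG : X.IsFinalLog G) (hp : p ∈ X.correct)
    {e sn : ℕ} (hsn : sn ∈ seqNrs cfg e) :
    (leaders cfg (finalLog G) e = [] ∧ G sn = none) ∨
    ∃ t, ∃ I ∈ segments cfg X.signed (finalLog G) e,
      sn ∈ I.seqNrs ∧ X.event t p = .sbDeliver I sn (G sn) := by
  obtain ⟨T, hT⟩ := hG.eventually p hp sn
  obtain ⟨t, -, hv, hs⟩ := h.exists_log_epoch hp (hT T le_rfl)
  obtain rfl : (X.state t p).epoch = e :=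
    (div_eq_of_mem_seqNrs hs).symm.trans (div_eq_of_mem_seqNrs hsn)
  rcases h.origin hp t sn _ (mem_seqNrs.mp hs).1 hv with ⟨h0, h1⟩ | ⟨t', -, I, hI, hsI, ha⟩
  · rw [leaders_congr (h.log_eq_finalLog hG hp t)] at h0
    exact Or.inl ⟨h0, h1⟩
  · rw [segments_congr (h.log_eq_finalLog hG hp t)] at hI
    exact Or.inr ⟨t', I, hI, hsI, ha⟩

/-- Nothing is delivered if the epochs are empty. -/
theorem Execution.IsRun.not_delivers (h : X.IsRun cfg) (hL : cfg.epochLength = 0)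
    (hp : p ∈ X.correct) (s : ℕ) (r : Request Payload Client) : ¬ X.Delivers p s r := by
  rintro ⟨t, -, b, hb, -⟩
  rw [(h.log_shape hp t).2.1 _ (by simp [hL])] at hb
  cases hb

theorem mem_seqNrs_div (hL : 1 ≤ cfg.epochLength) (sn : ℕ) :
    sn ∈ seqNrs cfg (sn / cfg.epochLength) :=
  mem_seqNrs.mpr ⟨Nat.div_mul_le_self _ _, by rw [mul_comm]; exact Nat.lt_mul_div_succ sn hL⟩

/-- The requests in the final log are signed. -/
theorem Execution.IsRun.final_signed (h : X.IsRun cfg) (hL : 1 ≤ cfg.epochLength)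
    (hG : X.IsFinalLog G) (hp : p ∈ X.correct) {sn : ℕ} {b : Batch Payload Client}
    (hb : G sn = some b) {r : Request Payload Client} (hr : r ∈ b) : r ∈ X.signed := by
  rcases h.final_origin hG hp (mem_seqNrs_div hL sn) with ⟨-, h0⟩ | ⟨t, I, hI, -, ha⟩
  · rw [hb] at h0
    cases h0
  · have hm := ((h.sb I).domain t p hp sn _ ha).2 b hb
    obtain ⟨l, hl, rfl⟩ := hI
    exact (hm r hr).1.1

/-- The counters of a correct node change only when it delivers a batch. -/
theorem Execution.IsRun.counters_step (h : X.IsRun cfg) (hG : X.IsFinalLog G)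
    (hp : p ∈ X.correct) (t : ℕ) :
    (X.event t p = .deliver ∧
      (X.state (t + 1) p).firstUndelivered = (X.state t p).firstUndelivered + 1 ∧
      (X.state (t + 1) p).totalDelivered = (X.state t p).totalDelivered +
        entrySize (G (X.state t p).firstUndelivered)) ∨
    (X.event t p ≠ .deliver ∧
      (X.state (t + 1) p).firstUndelivered = (X.state t p).firstUndelivered ∧
      (X.state (t + 1) p).totalDelivered = (X.state t p).totalDelivered) := by
  have hs := h.nodes.step t p hp
  have he := h.nodes.enabled t p hp
  rcases ha : X.event t p with _ | r | ⟨I, sn⟩ | ⟨I, sn, _ | b⟩ | _ | _ <;> rw [ha] at hs he <;>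
    rw [hs]
  · right; simp [next]
  · right; simp only [next]; split_ifs <;> simp
  · right; simp [next]
  · right; simp [next]
  · right; simp [next]
  · right; simp [next]
  · left
    obtain ⟨v, hv⟩ := Option.ne_none_iff_exists'.mp he
    have hv' := hG.eq p hp t _ v hv
    simp only [next, hv, ← hv', true_and]
    cases v <;> rfl

theorem Execution.IsRun.totalDelivered_eq (h : X.IsRun cfg) (hG : X.IsFinalLog G)
    (hp : p ∈ X.correct) (t : ℕ) :
    (X.state t p).totalDelivered = requestOffset G (X.state t p).firstUndelivered := by
  induction t with
  | zero => rw [h.nodes.init p hp]; simp [initialState, requestOffset]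
  | succ t ih =>
    rcases h.counters_step hG hp t with ⟨-, h1, h2⟩ | ⟨-, h1, h2⟩
    · rw [h1, h2, requestOffset_succ, ih]
    · rw [h1, h2, ih]

/-- A correct node eventually delivers the entry that it has to deliver next. -/
theorem Execution.IsRun.exists_deliver (h : X.IsRun cfg) (hG : X.IsFinalLog G)
    (hp : p ∈ X.correct) (t : ℕ) : ∃ t', X.event t' p = .deliver ∧
      (X.state t' p).firstUndelivered = (X.state t p).firstUndelivered := by
  by_contra! hne
  -- Without a delivery the pointer is frozen at an entry that eventually exists, so delivery stays
  -- enabled, against fairness.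
  have h1 : ∀ t' ≥ t, (X.state t' p).firstUndelivered = (X.state t p).firstUndelivered := by
    intro t' ht'
    induction t', ht' using Nat.le_induction with
    | base => rfl
    | succ t' _ ih =>
      rcases h.counters_step hG hp t' with ⟨h2, -⟩ | ⟨-, h2, -⟩
      · exact absurd ih (hne t' h2)
      · rw [h2, ih]
  obtain ⟨T, hT⟩ := hG.eventually p hp (X.state t p).firstUndelivered
  obtain ⟨t', ht', h2⟩ := h.nodes.fair p hp .deliver trivial (max t T)
  have h3 := h1 t' (le_of_max_le_left ht')
  rcases h2 with h2 | h2
  · exact hne t' h2 h3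
  · apply h2
    simp only [Enabled]
    rw [h3, hT t' (le_of_max_le_right ht')]
    simp

theorem Execution.IsRun.exists_deliver_eq (h : X.IsRun cfg) (hG : X.IsFinalLog G)
    (hp : p ∈ X.correct) (sn : ℕ) : ∃ t, X.event t p = .deliver ∧
      (X.state t p).firstUndelivered = sn := by
  induction sn with
  | zero =>
    obtain ⟨t, ht, h1⟩ := h.exists_deliver hG hp 0
    refine ⟨t, ht, h1.trans ?_⟩
    rw [h.nodes.init p hp]
    rfl
  | succ sn ih =>
    obtain ⟨t, ht, h1⟩ := ih
    obtain ⟨t', ht', h2⟩ := h.exists_deliver hG hp (t + 1)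
    refine ⟨t', ht', h2.trans ?_⟩
    rcases h.counters_step hG hp t with ⟨-, h3, -⟩ | ⟨h3, -⟩
    · rw [h3, h1]
    · exact absurd ht h3

/-- Every correct node delivers exactly the requests in the final log. -/
theorem Execution.IsRun.delivers_iff (h : X.IsRun cfg) (hG : X.IsFinalLog G) (hp : p ∈ X.correct)
    {s : ℕ} {r : Request Payload Client} : X.Delivers p s r ↔
      ∃ sn b k, G sn = some b ∧ b[k]? = some r ∧ s = requestOffset G sn + k := by
  constructor
  · rintro ⟨t, -, b, hb, k, hk, hs⟩
    rw [h.totalDelivered_eq hG hp] at hs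
    exact ⟨_, b, k, (hG.eq p hp t _ _ hb).symm, hk, hs⟩
  · rintro ⟨sn, b, k, hb, hk, hs⟩
    obtain ⟨t, ht, rfl⟩ := h.exists_deliver_eq hG hp sn
    refine ⟨t, ht, b, ?_, k, hk, by rw [h.totalDelivered_eq hG hp, hs]⟩
    have he := h.nodes.enabled t p hp
    rw [ht] at he
    obtain ⟨v, hv⟩ := Option.ne_none_iff_exists'.mp he
    rw [hv, hG.eq p hp t _ v hv, hb]

theorem Execution.IsRun.smrIntegrity (h : X.IsRun cfg) (hL : 1 ≤ cfg.epochLength)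
    (hG : X.IsFinalLog G) (hc : X.ClientsCorrect cfg) :
    SMRIntegrity X.correct X.correctClients X.bcast X.Delivers := by
  intro p hp s r hd hr
  obtain ⟨sn, b, k, hb, hk, -⟩ := (h.delivers_iff hG hp).mp hd
  exact hc.unforgeable r (h.final_signed hL hG hp hb (List.mem_of_getElem? hk)) hr

theorem Execution.IsRun.smrAgreement (h : X.IsRun cfg) (hG : X.IsFinalLog G) :
    SMRAgreement X.correct X.Delivers := by
  intro p hp q hq s r r' hd hd'
  obtain ⟨sn, b, k, hb, hk, hs⟩ := (h.delivers_iff hG hp).mp hd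
  obtain ⟨sn', b', k', hb', hk', hs'⟩ := (h.delivers_iff hG hq).mp hd'
  obtain ⟨rfl, rfl⟩ := requestOffset_inj (G := G) (sn := sn) (sn' := sn') (k := k) (k' := k')
    (by simpa [hb, entrySize] using (List.getElem?_eq_some_iff.mp hk).1)
    (by simpa [hb', entrySize] using (List.getElem?_eq_some_iff.mp hk').1) (hs.symm.trans hs')
  obtain rfl : b = b' := Option.some.inj (hb.symm.trans hb')
  exact Option.some.inj (hk.symm.trans hk')

/-- The criterion of `delivers_iff` does not mention the node. -/
theorem Execution.IsRun.smrTotality (h : X.IsRun cfg) (hG : X.IsFinalLog G) :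
    SMRTotality X.correct X.Delivers :=
  fun _ hp _ _ hd _ hq => (h.delivers_iff hG hq).mpr ((h.delivers_iff hG hp).mp hd)

end Delivery

/-! ### Existence of a reliable correct node that leads all late epochs -/

section StableLeaders

variable {n : ℕ} {Payload : Type u} {Client : Type v} {cfg : Config n Client}
  {log : Log Payload Client}

/-- Node `i` is responsible for the entry `⊥` at `sn`. -/
def Fails (cfg : Config n Client) (log : Log Payload Client) (i : Fin n) (sn : ℕ) : Prop :=
  leaderOf cfg (leaders cfg log) sn = some i ∧ log sn = some none

/-- Node `i` fails only finitely often. -/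
def EventuallyReliable (cfg : Config n Client) (log : Log Payload Client) (i : Fin n) : Prop :=
  ∃ N, ∀ sn ≥ N, ¬ Fails cfg log i sn

/-- Node `i` is a leader of all but finitely many epochs. -/
def EventuallyLeader (cfg : Config n Client) (log : Log Payload Client) (i : Fin n) : Prop :=
  ∃ E, ∀ e ≥ E, i ∈ leaders cfg log e

theorem fails_of_lastFailure_eq {i : Fin n} {e sn : ℕ}
    (h : lastFailure cfg (leaders cfg log) log i e = (sn : WithBot ℕ)) : Fails cfg log i sn := by
  classical
  exact (Finset.mem_filter.mp (Finset.mem_of_max h)).2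

theorem le_lastFailure {i : Fin n} {e sn : ℕ} (h : Fails cfg log i sn)
    (hsn : sn < e * cfg.epochLength) :
    (sn : WithBot ℕ) ≤ lastFailure cfg (leaders cfg log) log i e := by
  classical
  exact Finset.le_max (Finset.mem_filter.mpr ⟨Finset.mem_range.mpr hsn, h⟩)

theorem lastFailure_lt {i : Fin n} {N : ℕ} (h : ∀ sn ≥ N, ¬ Fails cfg log i sn) (e : ℕ) :
    lastFailure cfg (leaders cfg log) log i e < (N : WithBot ℕ) := by
  rcases hm : lastFailure cfg (leaders cfg log) log i e with _ | sn
  · exact WithBot.bot_lt_coe N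
  · by_contra hlt
    exact h sn (WithBot.coe_le_coe.mp (not_lt.mp hlt)) (fails_of_lastFailure_eq hm)

theorem lastFailure_eq {i : Fin n} {N e e' : ℕ} (h : ∀ sn ≥ N, ¬ Fails cfg log i sn)
    (he : N ≤ e * cfg.epochLength) (he' : N ≤ e' * cfg.epochLength) :
    lastFailure cfg (leaders cfg log) log i e = lastFailure cfg (leaders cfg log) log i e' := by
  classical
  unfold lastFailure
  congr 1
  ext sn
  simp only [Finset.mem_filter, Finset.mem_range]
  constructor <;> rintro ⟨-, h2⟩ <;> refine ⟨?_, h2⟩ <;> by_contra hlt <;>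
    exact h sn (by omega) h2

/-- A position has only one responsible node. Hence recency of failure orders the nodes that have
failed without ties, which is what bounds the size of the blacklist. -/
theorem lastFailure_injective {i j : Fin n} {e : ℕ}
    (hi : lastFailure cfg (leaders cfg log) log i e ≠ ⊥)
    (h : lastFailure cfg (leaders cfg log) log i e = lastFailure cfg (leaders cfg log) log j e) :
    i = j := by
  obtain ⟨sn, hsn⟩ := WithBot.ne_bot_iff_exists.mp hi
  have h1 := fails_of_lastFailure_eq hsn.symm
  have h2 := fails_of_lastFailure_eq (h.symm.trans hsn.symm)
  exact Option.some.inj (h1.1.symm.trans h2.1)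

open Classical in
/-- At most `f` nodes are blacklisted. -/
theorem card_blacklisted_le (log : Log Payload Client) (e : ℕ) :
    (Finset.univ.filter (fun i => Blacklisted cfg (leaders cfg log) log i e)).card ≤ cfg.f := by
  set B := Finset.univ.filter (fun i => Blacklisted cfg (leaders cfg log) log i e) with hB
  rcases B.eq_empty_or_nonempty with h0 | hne
  · simp [h0]
  -- For the blacklisted node with the oldest last failure, all other blacklisted nodes failed
  -- later, so there are fewer than `f` of them.
  obtain ⟨i, hi, hmin⟩ :=
    B.exists_min_image (fun i => lastFailure cfg (leaders cfg log) log i e) hne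
  have hbi := (Finset.mem_filter.mp hi).2
  have hsub : B.erase i ⊆ Finset.univ.filter (fun j =>
      lastFailure cfg (leaders cfg log) log i e < lastFailure cfg (leaders cfg log) log j e) := by
    intro j hj
    rw [Finset.mem_erase] at hj
    refine Finset.mem_filter.mpr ⟨Finset.mem_univ _, lt_of_le_of_ne (hmin j hj.2) fun heq => ?_⟩
    exact hj.1 (lastFailure_injective hbi.1 heq).symm
  have h1 := Finset.card_le_card hsub
  have h2 := Finset.card_erase_add_one hi
  have h3 := hbi.2
  omega

theorem mem_leaders_simple (hpol : cfg.policy = .simple) (i : Fin n) (e : ℕ) :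
    i ∈ leaders cfg log e := by
  simp [leaders, policyLeaders, hpol]

theorem mem_leaders_backoff (hpol : cfg.policy = .backoff) {i : Fin n} {e : ℕ} :
    i ∈ leaders cfg log e ↔ penalty cfg (leaders cfg log) log i e ≤ 0 := by
  rw [leaders_eq_policyLeaders]
  simp [policyLeaders, hpol]

theorem mem_leaders_blacklist (hpol : cfg.policy = .blacklist) {i : Fin n} {e : ℕ} :
    i ∈ leaders cfg log e ↔ ¬ Blacklisted cfg (leaders cfg log) log i e := by
  rw [leaders_eq_policyLeaders]
  simp [policyLeaders, hpol]

/-- Under BACKOFF, a node that fails only finitely often is eventually always a leader. -/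
theorem EventuallyReliable.eventuallyLeader_backoff {i : Fin n}
    (h : EventuallyReliable cfg log i) (hpol : cfg.policy = .backoff)
    (hL : 1 ≤ cfg.epochLength) (hd : 1 ≤ cfg.decrease) : EventuallyLeader cfg log i := by
  obtain ⟨N, hN⟩ := h
  have hs : ∀ e ≥ N, ¬ suspect cfg (leaders cfg log) log i e := by
    rintro e he ⟨sn, hsn, hm⟩
    refine hN sn ?_ (fails_of_lastFailure_eq hm)
    have := (mem_seqNrs.mp hsn).1
    nlinarith
  -- A positive penalty drops by at least one per epoch without failure, and a nonpositive one stays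
  -- put; it may overshoot below zero, hence only an upper bound.
  have hpen : ∀ k : ℕ, penalty cfg (leaders cfg log) log i (N + k) ≤
      max 0 (penalty cfg (leaders cfg log) log i N - k) := by
    intro k
    induction k with
    | zero => simp
    | succ k ih =>
      rw [← add_assoc, penalty, if_neg (hs (N + k) (by omega))]
      push_cast
      split_ifs <;> omega
  refine ⟨N + (penalty cfg (leaders cfg log) log i N).toNat, fun e he => ?_⟩
  rw [mem_leaders_backoff hpol]
  have := hpen (e - N)
  rw [Nat.add_sub_cancel' (by omega)] at this
  omega

/-- Under BLACKLIST, some correct node fails only finitely often and is eventually always a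
leader. -/
theorem exists_stable_leader_blacklist (hpol : cfg.policy = .blacklist)
    (hL : 1 ≤ cfg.epochLength) {correct : Finset (Fin n)} (hcard : cfg.f < correct.card)
    {p : Fin n} (hp : p ∈ correct) (hrel : EventuallyReliable cfg log p) :
    ∃ q ∈ correct, EventuallyReliable cfg log q ∧ EventuallyLeader cfg log q := by
  classical
  set F := lastFailure cfg (leaders cfg log) log with hF
  set U := Finset.univ.filter (fun i => ¬ EventuallyReliable cfg log i) with hU
  have h1 : ∀ i, ∃ N, EventuallyReliable cfg log i → ∀ sn ≥ N, ¬ Fails cfg log i sn := by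
    intro i
    by_cases hi : EventuallyReliable cfg log i
    · exact hi.imp fun N hN _ => hN
    · exact ⟨0, fun h => absurd h hi⟩
  choose N hN using h1
  -- `M` separates the nodes: last failures of reliable nodes lie below it forever, those of the
  -- others are at or above it from epoch `E` on.
  set M := Finset.univ.sup N with hM
  have hNM : ∀ i, EventuallyReliable cfg log i → ∀ sn ≥ M, ¬ Fails cfg log i sn := fun i hi sn hsn =>
    hN i hi sn ((Finset.le_sup (Finset.mem_univ i)).trans hsn)
  have h2 : ∀ i, ∃ e₀, ¬ EventuallyReliable cfg log i → ∀ e ≥ e₀, (M : WithBot ℕ) ≤ F i e := by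
    intro i
    by_cases hi : EventuallyReliable cfg log i
    · exact ⟨0, fun h => absurd hi h⟩
    · unfold EventuallyReliable at hi
      push Not at hi
      obtain ⟨sn, hsn, hf⟩ := hi M
      refine ⟨sn + 1, fun _ e he => le_trans (by exact_mod_cast hsn) (le_lastFailure hf ?_)⟩
      nlinarith
  choose e₀ he₀ using h2
  set E := max M (Finset.univ.sup e₀) with hE
  have hEL : ∀ e ≥ E, M ≤ e * cfg.epochLength := by
    intro e he
    have : M ≤ e := (le_max_left _ _).trans he
    nlinarith
  have hlow : ∀ i, EventuallyReliable cfg log i → ∀ e, F i e < (M : WithBot ℕ) := fun i hi e =>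
    lastFailure_lt (hNM i hi) e
  have hconst : ∀ i, EventuallyReliable cfg log i → ∀ e ≥ E, F i e = F i E := fun i hi e he =>
    lastFailure_eq (hNM i hi) (hEL e he) (hEL E le_rfl)
  have hhigh : ∀ i, ¬ EventuallyReliable cfg log i → ∀ e ≥ E, (M : WithBot ℕ) ≤ F i e :=
    fun i hi e he => he₀ i hi e
      (((Finset.le_sup (Finset.mem_univ i)).trans (le_max_right _ _)).trans he)
  -- From `E` on, the nodes that failed later than a reliable one are fixed: other reliable nodes
  -- have constant last failures, and all unreliable nodes are above.
  have hstable : ∀ i, EventuallyReliable cfg log i → ∀ e ≥ E,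
      (Blacklisted cfg (leaders cfg log) log i e ↔ Blacklisted cfg (leaders cfg log) log i E) := by
    intro i hi e he
    unfold Blacklisted
    have : Finset.univ.filter (fun j => F i e < F j e) =
        Finset.univ.filter (fun j => F i E < F j E) := by
      refine Finset.filter_congr fun j _ => ?_
      by_cases hj : EventuallyReliable cfg log j
      · rw [hconst i hi e he, hconst j hj e he]
      · exact iff_of_true ((hlow i hi e).trans_le (hhigh j hj e he))
          ((hlow i hi E).trans_le (hhigh j hj E le_rfl))
    rw [← hF, hconst i hi e he, ← this, hconst i hi e he]
  by_cases hex : ∃ q ∈ correct, EventuallyReliable cfg log q ∧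
      ¬ Blacklisted cfg (leaders cfg log) log q E
  · obtain ⟨q, hq, hqr, hqb⟩ := hex
    refine ⟨q, hq, hqr, E, fun e he => ?_⟩
    rw [mem_leaders_blacklist hpol, hstable q hqr e he]
    exact hqb
  -- Now every reliable correct node is blacklisted. All unreliable nodes failed later than `p`, so
  -- there are fewer than `f` of them; only they can have failed later than an unreliable node, so
  -- every unreliable node is blacklisted too. Thus more than `f` correct nodes are blacklisted.
  · push Not at hex
    exfalso
    have hUf : U.card < cfg.f := by
      refine lt_of_le_of_lt (Finset.card_le_card ?_) (hex p hp hrel).2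
      intro j hj
      exact Finset.mem_filter.mpr ⟨Finset.mem_univ _,
        (hlow p hrel E).trans_le (hhigh j (Finset.mem_filter.mp hj).2 E le_rfl)⟩
    have hsub : correct ⊆
        Finset.univ.filter (fun i => Blacklisted cfg (leaders cfg log) log i E) := by
      intro i hi
      refine Finset.mem_filter.mpr ⟨Finset.mem_univ _, ?_⟩
      by_cases hir : EventuallyReliable cfg log i
      · exact hex i hi hir
      · refine ⟨ne_bot_of_le_ne_bot WithBot.coe_ne_bot (hhigh i hir E le_rfl), ?_⟩
        refine lt_of_le_of_lt (Finset.card_le_card ?_) hUf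
        intro j hj
        refine Finset.mem_filter.mpr ⟨Finset.mem_univ _, fun hjr => ?_⟩
        exact absurd (Finset.mem_filter.mp hj).2
          (not_lt.mpr (((hlow j hjr E).trans_le (hhigh i hir E le_rfl)).le))
    have := Finset.card_le_card hsub
    have := card_blacklisted_le (cfg := cfg) log E
    omega

/-- Under each of the three policies, some correct node fails only finitely often and is
eventually always a leader, provided that some correct node fails only finitely often. -/
theorem exists_stable_leader (hL : 1 ≤ cfg.epochLength) (hd : 1 ≤ cfg.decrease)
    {correct : Finset (Fin n)} (hcard : cfg.f < correct.card) {p : Fin n} (hp : p ∈ correct)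
    (hrel : EventuallyReliable cfg log p) :
    ∃ q ∈ correct, EventuallyReliable cfg log q ∧ EventuallyLeader cfg log q := by
  rcases hpol : cfg.policy
  · exact ⟨p, hp, hrel, 0, fun e _ => mem_leaders_simple hpol p e⟩
  · exact ⟨p, hp, hrel, hrel.eventuallyLeader_backoff hpol hL hd⟩
  · exact exists_stable_leader_blacklist hpol hL hcard hp hrel

end StableLeaders

/-! ### Liveness: proposals, queues and watermarks at a stable leader -/

section Liveness

variable {n : ℕ} {Payload : Type u} {Client : Type v}
  {cfg : Config n Client} {X : Execution n Payload Client} {p q : Fin n} {t : ℕ}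
  {G : ℕ → Option (Batch Payload Client)}

theorem leaders_ne_nil_of_leaderOf {log : Log Payload Client} {e sn : ℕ} {i : Fin n}
    (h : leaderOf cfg (leaders cfg log) sn = some i) (hsn : sn ∈ seqNrs cfg e) :
    leaders cfg log e ≠ [] := by
  intro h0
  simp [leaderOf, div_eq_of_mem_seqNrs hsn, h0] at h

/-- A correct node that is eventually never suspected fails only finitely often. -/
theorem Execution.IsRun.eventuallyReliable (h : X.IsRun cfg) (hL : 1 ≤ cfg.epochLength)
    (hG : X.IsFinalLog G) (hp : p ∈ X.correct) {T : ℕ}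
    (hT : ∀ t ≥ T, ∀ q ∈ X.correct, p ∉ X.suspects t q) :
    EventuallyReliable cfg (finalLog G) p := by
  -- These positions lie in epochs from `T` on. A node enters at most one epoch per time unit, so
  -- any suspicion after initializing such an instance occurs at time `T` or later.
  refine ⟨T * cfg.epochLength, fun sn hsn hf => ?_⟩
  have hs := mem_seqNrs_div (cfg := cfg) hL sn
  have hG0 : G sn = none := Option.some.inj hf.2
  rcases h.final_origin hG hp hs with ⟨h0, -⟩ | ⟨t, I, hI, hsI, ha⟩
  · exact leaders_ne_nil_of_leaderOf hf.1 hs h0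
  · rw [hG0] at ha
    obtain rfl : I.leader = p :=
      Option.some.inj ((leaderOf_of_mem_segments hI hsI).symm.trans hf.1)
    obtain ⟨q, hq, t₀, t₁, ht, hact, hsus⟩ := (h.sb I).eventualProgress t _ hp sn hsI ha
    refine hT t₁ ?_ q hq hsus
    have h1 : (X.state t₀ q).epoch = sn / cfg.epochLength :=
      (epoch_of_mem_segments hact).symm.trans (epoch_of_mem_segments hI)
    have h2 := h.epoch_le hq t₀
    have h3 : T ≤ sn / cfg.epochLength := (Nat.le_div_iff_mul_le hL).mpr hsn
    omega

/-! ### Proposals -/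

theorem Execution.IsRun.propose_enabled (h : X.IsRun cfg) (hp : p ∈ X.correct)
    {I : Segment n Payload Client} {sn : ℕ} (ha : X.event t p = .propose I sn) :
    I ∈ (X.state t p).segments cfg X.signed ∧ I.leader = p ∧ sn ∈ I.seqNrs ∧
      (X.state t p).proposed sn = none ∧ (X.state t p).log sn = none := by
  have := h.nodes.enabled t p hp
  rwa [ha] at this

theorem Execution.IsRun.proposed_step (h : X.IsRun cfg) (hp : p ∈ X.correct) (t : ℕ) :
    (X.state (t + 1) p).proposed = (X.state t p).proposed ∨
    ∃ I sn, X.event t p = .propose I sn ∧ (X.state (t + 1) p).proposed =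
      Function.update (X.state t p).proposed sn
        (some (cutBatch cfg X.signed (X.state t p) I)) := by
  have hs := h.nodes.step t p hp
  rcases ha : X.event t p with _ | r | ⟨I, sn⟩ | ⟨I, sn, _ | b⟩ | _ | _ <;> rw [ha] at hs <;> rw [hs]
  · left; rfl
  · left; simp only [next]; split_ifs <;> rfl
  · right; exact ⟨I, sn, rfl, rfl⟩
  all_goals left; rfl

/-- Proposing is enabled only where nothing was proposed before, so a proposal is never replaced. -/
theorem Execution.IsRun.proposed_persist (h : X.IsRun cfg) (hp : p ∈ X.correct) {t t' : ℕ}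
    (ht : t ≤ t') {sn : ℕ} {b : Batch Payload Client} (hb : (X.state t p).proposed sn = some b) :
    (X.state t' p).proposed sn = some b := by
  induction t', ht using Nat.le_induction with
  | base => exact hb
  | succ t' _ ih =>
    rcases h.proposed_step hp t' with h' | ⟨I, k, ha, h'⟩
    · rw [h', ih]
    · have := (h.propose_enabled hp ha).2.2.2.1
      rw [h', Function.update_of_ne, ih]
      rintro rfl
      rw [this] at ih
      cases ih

/-- A correct node proposes only for the sequence numbers for which it is responsible. -/
theorem Execution.IsRun.leaderOf_of_proposed (h : X.IsRun cfg) (hG : X.IsFinalLog G)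
    (hp : p ∈ X.correct) {sn : ℕ} {b : Batch Payload Client}
    (hb : (X.state t p).proposed sn = some b) :
    leaderOf cfg (leaders cfg (finalLog G)) sn = some p := by
  induction t with
  | zero => rw [h.nodes.init p hp] at hb; cases hb
  | succ t ih =>
    rcases h.proposed_step hp t with h' | ⟨I, k, ha, h'⟩
    · rw [h'] at hb
      exact ih hb
    · obtain ⟨hI, rfl, hk, -⟩ := h.propose_enabled hp ha
      rw [h'] at hb
      by_cases hks : sn = k
      · subst hks
        rw [h.segments_eq hG hp] at hI
        exact leaderOf_of_mem_segments hI hk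
      · rw [Function.update_of_ne hks] at hb
        exact ih hb

/-- A batch in the final log for which a correct node is responsible was proposed by this node. -/
theorem Execution.IsRun.exists_propose (h : X.IsRun cfg) (hL : 1 ≤ cfg.epochLength)
    (hG : X.IsFinalLog G) (hp : p ∈ X.correct) {sn : ℕ} {b : Batch Payload Client}
    (hl : leaderOf cfg (leaders cfg (finalLog G)) sn = some p) (hb : G sn = some b) :
    ∃ t, ∃ I ∈ segments cfg X.signed (finalLog G) (sn / cfg.epochLength), sn ∈ I.seqNrs ∧
      X.event t p = .propose I sn ∧ b = cutBatch cfg X.signed (X.state t p) I := by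
  have hs := mem_seqNrs_div (cfg := cfg) hL sn
  rcases h.final_origin hG hp hs with ⟨-, h0⟩ | ⟨t, I, hI, hsI, ha⟩
  · rw [hb] at h0
    cases h0
  · obtain rfl : I.leader = p :=
      Option.some.inj ((leaderOf_of_mem_segments hI hsI).symm.trans hl)
    rw [hb] at ha
    obtain ⟨t', h1, h2⟩ := (h.sb I).integrity hp t _ hp sn b ha
    exact ⟨t', I, hI, hsI, h1, h2⟩

/-- By SB integrity `m` was itself proposed by `p` at this position, and the recorded proposal never
changes. -/
theorem Execution.IsRun.final_eq_proposed (h : X.IsRun cfg) (hL : 1 ≤ cfg.epochLength)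
    (hG : X.IsFinalLog G) (hp : p ∈ X.correct) {sn : ℕ} {b m : Batch Payload Client}
    (hb : (X.state t p).proposed sn = some b) (hm : G sn = some m) : m = b := by
  obtain ⟨t', I, -, -, ha, rfl⟩ :=
    h.exists_propose hL hG hp (h.leaderOf_of_proposed hG hp hb) hm
  have h1 : (X.state (t' + 1) p).proposed sn = some (cutBatch cfg X.signed (X.state t' p) I) := by
    rw [h.nodes.step t' p hp, ha]
    simp [next]
  have h2 := h.proposed_persist hp (le_max_left (t' + 1) t) h1
  have h3 := h.proposed_persist hp (le_max_right (t' + 1) t) hb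
  exact Option.some.inj (h2.symm.trans h3)

/-! ### Queues -/

theorem Execution.IsRun.received_prefix (h : X.IsRun cfg) (hp : p ∈ X.correct) {t t' : ℕ}
    (ht : t ≤ t') : (X.state t p).received <+: (X.state t' p).received := by
  induction t', ht using Nat.le_induction with
  | base => exact List.prefix_rfl
  | succ t' _ ih =>
    refine ih.trans ?_
    have hs := h.nodes.step t' p hp
    rcases ha : X.event t' p with _ | r | ⟨I, sn⟩ | ⟨I, sn, _ | b⟩ | _ | _ <;> rw [ha] at hs <;>
      rw [hs]
    · exact List.prefix_rfl
    · simp only [next]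
      split_ifs
      · exact List.prefix_append _ _
      · exact List.prefix_rfl
    all_goals exact List.prefix_rfl

/-- A request that was received, but is neither in its queue nor in the final log, is part of a
proposal on which no decision has been taken. -/
theorem Execution.IsRun.pending_or_proposed (h : X.IsRun cfg) (hL : 1 ≤ cfg.epochLength)
    (hG : X.IsFinalLog G) (hp : p ∈ X.correct) {r : Request Payload Client}
    (hr : ∀ sn b, G sn = some b → r ∉ b) (t : ℕ) (hrec : r ∈ (X.state t p).received)
    (hpen : r ∉ (X.state t p).pending) :
    ∃ sn b, (X.state t p).proposed sn = some b ∧ r ∈ b ∧ (X.state t p).log sn = none := by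
  induction t with
  | zero => rw [h.nodes.init p hp] at hrec; simp [initialState] at hrec
  | succ t ih =>
    have hs := h.nodes.step t p hp
    rcases ha : X.event t p with _ | r' | ⟨I, sn⟩ | ⟨I, sn, _ | b⟩ | _ | _ <;> rw [ha] at hs
    · rw [hs] at hrec hpen ⊢
      exact ih hrec hpen
    · rw [hs] at hrec hpen ⊢
      simp only [next] at hrec hpen ⊢
      split_ifs at hrec hpen ⊢
      · simp only [Set.mem_union, Set.mem_singleton_iff, not_or, List.mem_append,
          List.mem_singleton] at hrec hpen
        exact ih (hrec.resolve_right hpen.2) hpen.1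
      · exact ih hrec hpen
    · obtain ⟨-, -, -, hpr, hlog⟩ := h.propose_enabled hp ha
      rw [hs] at hrec hpen ⊢
      simp only [next, Set.mem_sdiff, Set.mem_ofPred_eq, not_and_not_right] at hrec hpen ⊢
      by_cases hc : r ∈ cutBatch cfg X.signed (X.state t p) I
      · exact ⟨sn, _, Function.update_self .., hc, hlog⟩
      · obtain ⟨k, b, hb, hrb, hk⟩ := ih hrec (fun h' => hc (hpen h'))
        refine ⟨k, b, ?_, hrb, hk⟩
        rw [Function.update_of_ne, hb]
        rintro rfl
        rw [hpr] at hb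
        cases hb
    · rw [hs] at hrec hpen ⊢
      simp only [next, Set.mem_union, Set.mem_ofPred_eq, not_or] at hrec hpen ⊢
      obtain ⟨k, b, hb, hrb, hk⟩ := ih hrec hpen.1
      refine ⟨k, b, hb, hrb, ?_⟩
      rw [Function.update_of_ne, hk]
      rintro rfl
      exact hpen.2 ⟨b, hb, hrb⟩
    -- The delivered batch is final, so it does not contain `r`; were it decided at the position of
    -- the pending proposal, it would equal that proposal, which does.
    · have hGb : some b = G sn := hG.eq p hp _ _ _ (h.log_sbDeliver hp ha)
      rw [hs] at hrec hpen ⊢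
      simp only [next, Set.mem_sdiff, Set.mem_ofPred_eq, not_and_not_right] at hrec hpen ⊢
      obtain ⟨k, b', hb, hrb, hk⟩ := ih hrec (fun h' => hr sn b hGb.symm (hpen h'))
      refine ⟨k, b', hb, hrb, ?_⟩
      rw [Function.update_of_ne, hk]
      rintro rfl
      obtain rfl := h.final_eq_proposed hL hG hp hb hGb.symm
      exact hr _ _ hGb.symm hrb
    -- Skipping cannot decide the proposal: its position has a responsible leader.
    · have hfin := leaders_congr (h.log_eq_finalLog hG hp (t + 1))
      rw [hs] at hrec hpen hfin ⊢
      simp only [next] at hrec hpen hfin ⊢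
      obtain ⟨k, b, hb, hrb, hk⟩ := ih hrec hpen
      refine ⟨k, b, hb, hrb, ?_⟩
      simp only [fillSkipped]
      rw [if_neg, hk]
      rintro ⟨h0, hk'⟩
      rw [leaders_fillSkipped, h0] at hfin
      exact leaders_ne_nil_of_leaderOf (h.leaderOf_of_proposed hG hp hb) hk' hfin.symm
    · rw [hs] at hrec hpen ⊢
      exact ih hrec hpen

/-- Requests that are not in the final log stay in the queues of a node that does not fail any
more, once they have been received. -/
theorem Execution.IsRun.mem_pending (h : X.IsRun cfg) (hL : 1 ≤ cfg.epochLength)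
    (hG : X.IsFinalLog G) (hp : p ∈ X.correct) {N : ℕ}
    (hN : ∀ sn ≥ N, ¬ Fails cfg (finalLog G) p sn) (ht : N ≤ (X.state t p).epoch)
    {r : Request Payload Client} (hr : ∀ sn b, G sn = some b → r ∉ b)
    (hrec : r ∈ (X.state t p).received) : r ∈ (X.state t p).pending := by
  by_contra hpen
  obtain ⟨sn, b, hb, hrb, hlog⟩ := h.pending_or_proposed hL hG hp hr t hrec hpen
  have hsn : (X.state t p).epoch * cfg.epochLength ≤ sn := by
    by_contra hlt
    exact (h.log_shape hp t).1 sn (by omega) hlog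
  -- The undecided proposal belongs to a late epoch. If it ends in `⊥`, the node fails again;
  -- otherwise the proposal containing `r` becomes final.
  rcases hv : G sn with _ | m
  · refine hN sn (by nlinarith) ⟨h.leaderOf_of_proposed hG hp hb, ?_⟩
    rw [finalLog, hv]
  · obtain rfl := h.final_eq_proposed hL hG hp hb hv
    exact hr sn _ hv hrb

/-- The requests received before are not added to the queues of a node that does not fail any
more. -/
theorem Execution.IsRun.pending_antitone (h : X.IsRun cfg) (hL : 1 ≤ cfg.epochLength)
    (hG : X.IsFinalLog G) (hp : p ∈ X.correct) {N : ℕ}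
    (hN : ∀ sn ≥ N, ¬ Fails cfg (finalLog G) p sn) (ht : N ≤ (X.state t p).epoch)
    {r : Request Payload Client} (hrec : r ∈ (X.state t p).received)
    (hpen : r ∈ (X.state (t + 1) p).pending) : r ∈ (X.state t p).pending := by
  have hs := h.nodes.step t p hp
  rcases ha : X.event t p with _ | r' | ⟨I, sn⟩ | ⟨I, sn, _ | b⟩ | _ | _ <;> rw [ha] at hs
  · rwa [hs] at hpen
  · rw [hs] at hpen
    simp only [next] at hpen
    split_ifs at hpen with hc
    · rcases hpen with hpen | rfl
      · exact hpen
      · exact absurd hrec hc.2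
    · exact hpen
  · rw [hs] at hpen
    exact hpen.1
  · have hGv : none = G sn := hG.eq p hp _ _ _ (h.log_sbDeliver hp ha)
    have hI := h.nodes.enabled t p hp
    rw [ha] at hI
    have hsn := (mem_seqNrs.mp
      (seqNrs_of_mem_segments hI ((h.sb I).domain t p hp sn none ha).1)).1
    rw [hs] at hpen
    rcases hpen with hpen | ⟨b, hb, -⟩
    · exact hpen
    -- Requests return to a queue only when an own proposal ends in `⊥`, a failure excluded in late
    -- epochs.
    · refine absurd ⟨h.leaderOf_of_proposed hG hp hb, ?_⟩ (hN sn (by nlinarith))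
      rw [finalLog, ← hGv]
  · rw [hs] at hpen
    exact hpen.1
  · rwa [hs] at hpen
  · rwa [hs] at hpen

theorem exists_mod_eq (a l m : ℕ) (hl : l < m) : ∃ k, a ≤ k ∧ k < a + m ∧ k % m = l := by
  refine ⟨a + (l + m - a % m) % m, by omega, ?_, ?_⟩
  · have := Nat.mod_lt (l + m - a % m) (Nat.zero_lt_of_lt hl)
    omega
  · have h1 := Nat.div_add_mod a m
    have h2 := Nat.mod_lt a (Nat.zero_lt_of_lt hl)
    have h3 : a + (l + m - a % m) = l + m * (a / m + 1) := by rw [mul_add]; omega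
    rw [Nat.add_mod_mod, h3, Nat.add_mul_mod_self_left, Nat.mod_eq_of_lt hl]

/-- A node that is eventually always a leader and does not fail any more proposes in infinitely
many epochs in a segment with a given bucket. -/
theorem Execution.IsRun.exists_propose_bucket (h : X.IsRun cfg) (hL : n ≤ cfg.epochLength)
    (hG : X.IsFinalLog G) (hp : p ∈ X.correct) (hrel : EventuallyReliable cfg (finalLog G) p)
    (hlead : EventuallyLeader cfg (finalLog G) p) {b : ℕ} (hb : b < cfg.numBuckets) (E : ℕ) :
    ∃ t I sn, E ≤ (X.state t p).epoch ∧ X.event t p = .propose I sn ∧ b ∈ I.buckets := by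
  have hn : 0 < n := p.pos
  obtain ⟨N, hN⟩ := hrel
  obtain ⟨E', hE'⟩ := hlead
  -- A late epoch in which the rotation makes `p` the initial owner of `b`; no redistribution of
  -- buckets is needed.
  obtain ⟨e, he, hmod⟩ : ∃ e, max N (max E' E) ≤ e ∧ (b + e) % n = p := by
    obtain ⟨k, hk, -, hk'⟩ := exists_mod_eq (b + max N (max E' E)) p n p.isLt
    exact ⟨k - b, by omega, by rw [Nat.add_sub_cancel' (by omega), hk']⟩
  have hpl := hE' e (by omega)
  have hlen : (leaders cfg (finalLog G) e).length ≤ n := by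
    simpa using (nodup_leaders (finalLog G) e).length_le_card
  have hidx := List.idxOf_lt_length_of_mem hpl
  -- There are at most `n` leaders and `n ≤ L`, so the residue of every leader occurs within the
  -- epoch.
  obtain ⟨sn, h1, h2, h3⟩ := exists_mod_eq (e * cfg.epochLength) _ _ hidx
  have hsn : sn ∈ seqNrs cfg e := mem_seqNrs.mpr ⟨h1, by rw [add_mul]; omega⟩
  have hdiv := div_eq_of_mem_seqNrs hsn
  have hl : leaderOf cfg (leaders cfg (finalLog G)) sn = some p := by
    simp only [leaderOf, hdiv, h3]
    rw [List.getElem?_eq_getElem hidx, List.getElem_idxOf]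
  rcases hv : G sn with _ | m
  · refine absurd ⟨hl, by rw [finalLog, hv]⟩ (hN sn ?_)
    have : N ≤ e := by omega
    nlinarith
  · obtain ⟨t, I, hI, hsI, ha, -⟩ := h.exists_propose (hn.trans_le hL) hG hp hl hv
    have hI' := (h.propose_enabled hp ha).1
    have hep : (X.state t p).epoch = e :=
      (epoch_of_mem_segments hI').symm.trans ((epoch_of_mem_segments hI).trans hdiv)
    have hlI := leaderOf_of_mem_segments hI hsI
    obtain rfl : I.leader = p := Option.some.inj (hlI.symm.trans hl)
    refine ⟨t, I, sn, by omega, ha, ?_⟩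
    rw [hdiv] at hI
    obtain ⟨l, hll, rfl⟩ := hI
    exact Or.inl ⟨hb, hmod⟩

/-- A request that is valid in all late epochs and received by a node that is eventually always
a leader and does not fail any more is in the final log. -/
theorem Execution.IsRun.exists_mem_final (h : X.IsRun cfg) (hL : n ≤ cfg.epochLength)
    (hbuckets : 1 ≤ cfg.numBuckets) (hbatch : 1 ≤ cfg.maxBatchSize)
    (hG : X.IsFinalLog G) (hp : p ∈ X.correct) (hrel : EventuallyReliable cfg (finalLog G) p)
    (hlead : EventuallyLeader cfg (finalLog G) p) {r : Request Payload Client} {E : ℕ}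
    (hvalid : ∀ e ≥ E, Valid cfg X.signed (finalLog G) e r)
    (hrec : r ∈ (X.state t p).received) : ∃ sn b, G sn = some b ∧ r ∈ b := by
  classical
  by_contra! hr
  have hL' : 1 ≤ cfg.epochLength := p.pos.trans_le hL
  obtain ⟨N, hN⟩ := id hrel
  obtain ⟨t₁, ht₁⟩ := h.exists_epoch hp (max N E)
  set T := max t t₁ with hT
  have hepoch : ∀ t' ≥ T, max N E ≤ (X.state t' p).epoch := fun t' ht' =>
    ht₁ ▸ h.epoch_mono hp ((le_max_right _ _).trans ht')
  set R := (X.state T p).received with hR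
  have hRrec : ∀ t' ≥ T, ∀ r' ∈ R, r' ∈ (X.state t' p).received := fun t' ht' r' hr' =>
    (h.received_prefix hp ht').subset hr'
  have hrR : r ∈ R := (h.received_prefix hp (le_max_left _ _)).subset hrec
  -- The decreasing quantity: among the finitely many requests received by time `T`, those still
  -- queued. It never grows, and it shrinks at every proposal for the bucket of `r`.
  set S : ℕ → Finset (Request Payload Client) :=
    fun t' => R.toFinset.filter (· ∈ (X.state t' p).pending) with hS
  have hstep : ∀ t' ≥ T, S (t' + 1) ⊆ S t' := by
    intro t' ht' r' hr'
    simp only [hS, Finset.mem_filter, List.mem_toFinset] at hr' ⊢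
    exact ⟨hr'.1, h.pending_antitone hL' hG hp hN (by have := hepoch t' ht'; omega)
      (hRrec t' ht' r' hr'.1) hr'.2⟩
  have hanti : ∀ t' ≥ T, ∀ t'' ≥ t', S t'' ⊆ S t' := by
    intro t' ht' t'' ht''
    induction t'', ht'' using Nat.le_induction with
    | base => exact subset_rfl
    | succ t'' h' ih => exact (hstep t'' (ht'.trans h')).trans ih
  have hdrop : ∀ t' I sn, T ≤ t' → X.event t' p = .propose I sn → bucketOf cfg r ∈ I.buckets →
      S (t' + 1) ⊂ S t' := by
    intro t' I sn ht' ha hbr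
    have he := hepoch t' ht'
    have hrp : r ∈ (X.state t' p).pending :=
      h.mem_pending hL' hG hp hN (by omega) hr (hRrec t' ht' r hrR)
    have hrv : Valid cfg X.signed (X.state t' p).log (X.state t' p).epoch r :=
      (valid_congr (h.log_eq_finalLog hG hp t') r).mpr (hvalid _ (by omega))
    obtain ⟨l, hl⟩ : R <+: (X.state t' p).received := h.received_prefix hp ht'
    -- Later arrivals queue behind `R`, and `r` itself is eligible, so a batch of size at least one
    -- starts with an element `x` of `R`, possibly older than `r`.
    obtain ⟨x, hxR, hxc⟩ : ∃ x ∈ R.filter (fun r => r ∈ (X.state t' p).pending ∧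
        bucketOf cfg r ∈ I.buckets ∧ Valid cfg X.signed (X.state t' p).log (X.state t' p).epoch r),
        x ∈ cutBatch cfg X.signed (X.state t' p) I := by
      have hmem : r ∈ R.filter (fun r => r ∈ (X.state t' p).pending ∧
        bucketOf cfg r ∈ I.buckets ∧
          Valid cfg X.signed (X.state t' p).log (X.state t' p).epoch r) :=
        List.mem_filter.mpr ⟨hrR, decide_eq_true ⟨hrp, hbr, hrv⟩⟩
      unfold cutBatch
      rw [← hl, List.filter_append]
      rcases hf : R.filter (fun r => decide (r ∈ (X.state t' p).pending ∧
        bucketOf cfg r ∈ I.buckets ∧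
          Valid cfg X.signed (X.state t' p).log (X.state t' p).epoch r)) with _ | ⟨x, xs⟩
      · rw [hf] at hmem
        cases hmem
      · obtain ⟨k, hk⟩ := Nat.exists_eq_add_of_le' hbatch
        exact ⟨x, List.mem_cons_self, by simp [hk]⟩
    rw [List.mem_filter] at hxR
    have hxp := (of_decide_eq_true hxR.2).1
    refine Finset.ssubset_iff_of_subset (hstep t' ht') |>.mpr ⟨x, ?_, ?_⟩
    · exact Finset.mem_filter.mpr ⟨List.mem_toFinset.mpr hxR.1, hxp⟩
    · intro hx
      have hx' := (Finset.mem_filter.mp hx).2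
      rw [h.nodes.step t' p hp, ha] at hx'
      exact hx'.2 hxc
  have hbound : ∀ k, ∃ t' ≥ T, (S t').card + k ≤ (S T).card := by
    intro k
    induction k with
    | zero => exact ⟨T, le_rfl, le_rfl⟩
    | succ k ih =>
      obtain ⟨t', ht', hk⟩ := ih
      obtain ⟨t'', I, sn, he, ha, hbr⟩ := h.exists_propose_bucket hL hG hp hrel hlead
        (b := bucketOf cfg r) (Nat.mod_lt _ hbuckets) ((X.state t' p).epoch + 1)
      have hlt : t' ≤ t'' := by
        by_contra hlt
        have := h.epoch_mono hp (not_le.mp hlt).le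
        omega
      have h1 := Finset.card_lt_card (hdrop t'' I sn (ht'.trans hlt) ha hbr)
      have h2 := Finset.card_le_card (hanti t' ht' t'' hlt)
      exact ⟨t'' + 1, by omega, by omega⟩
  obtain ⟨t', -, hk⟩ := hbound ((S T).card + 1)
  omega

/-- A request of a correct client is valid in all late epochs, if it is the first of this client
that is not delivered. -/
theorem Execution.IsRun.eventually_valid (h : X.IsRun cfg) (hL : 1 ≤ cfg.epochLength)
    (hwindow : 1 ≤ cfg.windowSize) (hG : X.IsFinalLog G) (hc : X.ClientsCorrect cfg)
    (hp : p ∈ X.correct) {c : Client} (hcc : c ∈ X.correctClients) {r : Request Payload Client}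
    (hr : r ∈ X.bcast c) (hnew : ∀ sn b, G sn = some b → r ∉ b)
    (hold : ∀ r' ∈ X.bcast c, r'.ts < r.ts → ∃ sn b, G sn = some b ∧ r' ∈ b) :
    ∃ E, ∀ e ≥ E, Valid cfg X.signed (finalLog G) e r := by
  have h1 : ∀ k, ∃ sn, k < r.ts → ∃ b, G sn = some b ∧ ∃ r' ∈ b, r'.client = c ∧ r'.ts = k := by
    intro k
    by_cases hk : k < r.ts
    · obtain ⟨r', hr', rfl⟩ := hc.contiguous c hcc r hr k hk
      obtain ⟨sn, b, hb, hrb⟩ := hold r' hr' hk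
      exact ⟨sn, fun _ => ⟨b, hb, r', hrb, hc.own c hcc r' hr', rfl⟩⟩
    · exact ⟨0, fun h => absurd h hk⟩
  choose s hs using h1
  -- `s k` is a position holding a request with timestamp `k`. The extra one puts all these
  -- positions strictly below epoch `e`.
  refine ⟨(Finset.range r.ts).sup s + 1, fun e he => ?_⟩
  have hlow : lowWatermark cfg (finalLog G) e r.client = r.ts := by
    rw [hc.own c hcc r hr]
    refine le_antisymm (Nat.sInf_le ?_) (le_csInf ⟨r.ts, ?_⟩ ?_)
    -- The lower bound comes first; the two remaining goals both say that the timestamp of `r` is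
    -- unused in the log.
    rotate_right
    · intro k hk
      by_contra hlt
      obtain ⟨b, hb, r', hrb, hrc, hrt⟩ := hs k (by omega)
      refine hk (s k) ?_ b (by rw [finalLog, hb]) r' hrb hrc hrt
      have := Finset.le_sup (f := s) (Finset.mem_range.mpr (not_le.mp hlt))
      nlinarith
    all_goals
      intro sn _ b hb r' hrb hrc hrt
      have hb' : G sn = some b := Option.some.inj hb
      have hsig := h.final_signed hL hG hp hb' hrb
      have hbc := hc.unforgeable r' hsig (hrc ▸ hcc)
      rw [hrc] at hbc
      obtain rfl := hc.unique c hcc r' hbc r hr hrt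
      exact hnew sn b hb' hrb
  have hown := hc.own c hcc r hr
  exact ⟨hc.sign c hcc r hr, hown ▸ hc.member hcc, hlow.le, by omega⟩

/-- Strong induction over the timestamps of a client: once all earlier requests are in the final
log, the watermark window starts at an undelivered request and stays there. -/
theorem Execution.IsRun.smrLiveness (h : X.IsRun cfg) (hL : n ≤ cfg.epochLength)
    (hcard : cfg.f < X.correct.card) (hbuckets : 1 ≤ cfg.numBuckets)
    (hbatch : 1 ≤ cfg.maxBatchSize) (hdecrease : 1 ≤ cfg.decrease) (hwindow : 1 ≤ cfg.windowSize)
    (hG : X.IsFinalLog G) (hc : X.ClientsCorrect cfg)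
    (hFD : EventualWeakAccuracy X.correct X.suspects) :
    SMRLiveness X.correct X.correctClients X.bcast X.Delivers := by
  obtain ⟨p, hp, T, hT⟩ := hFD
  have hL' : 1 ≤ cfg.epochLength := p.pos.trans_le hL
  obtain ⟨q, hq, hrel, hlead⟩ := exists_stable_leader hL' hdecrease hcard hp
    (h.eventuallyReliable hL' hG hp hT)
  have hdel : ∀ r, (∃ sn b, G sn = some b ∧ r ∈ b) → ∃ p ∈ X.correct, ∃ s, X.Delivers p s r := by
    rintro r ⟨sn, b, hb, hrb⟩
    obtain ⟨k, hk⟩ := List.mem_iff_getElem?.mp hrb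
    exact ⟨p, hp, _, (h.delivers_iff hG hp).mpr ⟨sn, b, k, hb, hk, rfl⟩⟩
  intro c hcc r hr
  apply hdel
  induction hk : r.ts using Nat.strong_induction_on generalizing r with
  | _ k ih =>
    subst hk
    by_contra! hnew
    obtain ⟨E, hE⟩ := h.eventually_valid hL' hwindow hG hc hp hcc hr hnew
      (fun r' hr' hlt => ih _ hlt r' hr' rfl)
    rcases hc.transmit c hcc r hr with ⟨p', hp', s, hs⟩ | htr
    · obtain ⟨sn, b, k, hb, hk, -⟩ := (h.delivers_iff hG hp').mp hs
      exact hnew sn b hb (List.mem_of_getElem? hk)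
    · obtain ⟨t₀, ht₀⟩ := h.exists_epoch hq E
      obtain ⟨t, ht, ha⟩ := htr q hq t₀
      have hv : Valid cfg X.signed (X.state t q).log (X.state t q).epoch r :=
        (valid_congr (h.log_eq_finalLog hG hq t) r).mpr
          (hE _ (ht₀ ▸ h.epoch_mono hq ht))
      have hrec : r ∈ (X.state (t + 1) q).received := by
        rw [h.nodes.step t q hq, ha]
        simp only [next]
        split_ifs with hif
        · simp
        · by_contra hn
          exact hif ⟨hv, hn⟩
      obtain ⟨sn, b, hb, hrb⟩ := h.exists_mem_final hL hbuckets hbatch hG hq hrel hlead hE hrec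
      exact hnew sn b hb hrb

end Liveness

end ISS

theorem mainTheorem2 {n : ℕ} {Payload : Type u} {Client : Type v}
    (cfg : ISS.Config n Client)
    (hn : 3 * cfg.f + 1 ≤ n)
    (hbuckets : 1 ≤ cfg.numBuckets) (hbatch : 1 ≤ cfg.maxBatchSize)
    (hdecrease : 1 ≤ cfg.decrease) (hwindow : 1 ≤ cfg.windowSize)
    (X : ISS.Execution n Payload Client)
    (hfaulty : (X.correctᶜ).card ≤ cfg.f)
    (hnodes : X.NodesFollowISS cfg)
    (hclients : X.ClientsCorrect cfg)
    (hSB : ∀ I : ISS.Segment n Payload Client,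
      ISS.IsSB X.correct X.suspects I.leader I.seqNrs I.msgs (X.sbTrace cfg I))
    (hFD : ISS.EventualWeakAccuracy X.correct X.suspects) :
    ISS.SMRIntegrity X.correct X.correctClients X.bcast X.Delivers ∧
    ISS.SMRAgreement X.correct X.Delivers ∧
    ISS.SMRTotality X.correct X.Delivers ∧
    (n ≤ cfg.epochLength →
      ISS.SMRLiveness X.correct X.correctClients X.bcast X.Delivers) := by
  have h : X.IsRun cfg := ⟨hnodes, hSB⟩
  rcases Nat.eq_zero_or_pos cfg.epochLength with hL | hL
  · exact ⟨fun p hp s r hd => absurd hd (h.not_delivers hL hp s r),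
      fun p hp _ _ s r _ hd => absurd hd (h.not_delivers hL hp s r),
      fun p hp s r hd => absurd hd (h.not_delivers hL hp s r), fun h' => by omega⟩
  · obtain ⟨p, hp, -⟩ := id hFD
    obtain ⟨G, hG⟩ := h.exists_isFinalLog hL hp
    have hcard : cfg.f < X.correct.card := by
      rw [Finset.card_compl, Fintype.card_fin] at hfaulty
      omega
    exact ⟨h.smrIntegrity hL hG hclients, h.smrAgreement hG, h.smrTotality hG, fun hLn =>
      h.smrLiveness hLn hcard hbuckets hbatch hdecrease hwindow hG hclients hFD⟩
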